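/- A *finite ordered equivalence relation* is an equivalence relation on a finite set carrying a linear order, considered up to order-preserving isomorphism; equivalently, an equivalence relation $\sigma$ on $[n]=\{1,\dots,n\}$ for some $n\ge 0$, and then $|\sigma|=n$ is its length. Write $\sigma\le\tau$ (*consecutive embedding*) if there is an integer $k\geq 0$ with $k+|\sigma|\le|\tau|$ such that for all $i,j\in[|\sigma|]$: $i$ and $j$ are $\sigma$-equivalent if and only if $k+i$ and $k+j$ are $\tau$-equivalent. For a finite set $B$ of finite ordered equivalence relations let $\mathrm{Av}(B)$ be the set of all finite ordered equivalence relations $\tau$ with $\beta\not\le\tau$ for every $\beta\in B$. A poset is *wqo* if it has no infinite antichains and no infinite descending chains. Let $b=\max\{|\beta|:\beta\in B\}$ (and $b=0$ if $B=\emptyset$). The *factor graph* $\Gamma_B$ is the finite digraph (loops allowed) whose vertices are the equivalence relations on $[b]$ that lie in $\mathrm{Av}(B)$, with an edge $\mu\to\nu$ if and only if for all $1\le i,j\le b-1$: $i+1$ and $j+1$ are $\mu$-equivalent exactly when $i$ and $j$ are $\nu$-equivalent. A *cycle* is a path $v_1\to v_2\to\dots\to v_n$ with $n\ge 2$ and $v_1=v_n$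 (vertices may repeat). An *in-out cycle* is a cycle that contains at least one vertex of in-degree at least $2$ in $\Gamma_B$ and at least one vertex of out-degree at least $2$ in $\Gamma_B$. A vertex is *special* if $b\geq 1$ and its largest element $b$ forms a class of size one. **Theorem 8.4.** 1. There is an algorithm which, given a finite set $B$ of finite ordered equivalence relations, decides whether $\mathrm{Av}(B)$ is wqo under the consecutive embedding order. 2. If $B$ contains a relation of positive length, then $\mathrm{Av}(B)$ is wqo if and only if $\Gamma_B$ has no in-out cycle and no special vertex lying on a cycle. 3. Each of the two conditions in 2 is decidable: there is an algorithm which, given $B$, decides whether $\Gamma_B$ has an in-out cycle, and one which, given $B$, decides whether $\Gamma_B$ has a special vertex lying on a cycle. Here the input $B$ is given as a finite list of finite words of natural numbers, the word $w_1\cdots w_n$ standing for the equivalence relation on $[n]$ in which $i$ and $j$ are equivalent if and only if $w_i=w_j$. -/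

import Mathlib

/-- A finite linearly ordered equivalence relation, up to (order-preserving) isomorphism:
an equivalence relation on an initial segment `{0, …, len - 1}` of the natural numbers. -/
structure OrdEqRel where
  len : ℕ
  rel : Setoid (Fin len)

namespace OrdEqRel

/-- `f` is contiguous: it maps the points of `Fin n`, in order, to consecutive points. -/
def Contiguous {n m : ℕ} (f : Fin n → Fin m) : Prop :=
  ∃ k : ℕ, ∀ i : Fin n, (f i : ℕ) = k + i

/-- `σ` embeds consecutively in `τ`. -/
def ConsEmbeds (σ τ : OrdEqRel) : Prop :=
  ∃ f : Fin σ.len → Fin τ.len, Contiguous f ∧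
    ∀ x y : Fin σ.len, σ.rel.r x y ↔ τ.rel.r (f x) (f y)

theorem ConsEmbeds.refl (σ : OrdEqRel) : ConsEmbeds σ σ :=
  ⟨id, ⟨0, fun i => by simp⟩, fun _ _ => Iff.rfl⟩

theorem ConsEmbeds.trans {σ τ υ : OrdEqRel} (h₁ : ConsEmbeds σ τ) (h₂ : ConsEmbeds τ υ) :
    ConsEmbeds σ υ := by
  obtain ⟨f, ⟨k, hk⟩, hf⟩ := h₁
  obtain ⟨g, ⟨l, hl⟩, hg⟩ := h₂
  refine ⟨g ∘ f, ⟨l + k, fun i => ?_⟩, fun x y => (hf x y).trans (hg _ _)⟩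
  simp only [Function.comp_apply, hl, hk]
  omega

theorem Contiguous.injective {n m : ℕ} {f : Fin n → Fin m} (hf : Contiguous f) :
    Function.Injective f := by
  obtain ⟨k, hk⟩ := hf
  intro i j h
  have h₁ := hk i
  have h₂ := hk j
  rw [h] at h₁
  ext
  omega

theorem Contiguous.le {n m : ℕ} {f : Fin n → Fin m} (hf : Contiguous f) : n ≤ m := by
  simpa using Fintype.card_le_of_injective f hf.injective

theorem ConsEmbeds.antisymm {σ τ : OrdEqRel} (h₁ : ConsEmbeds σ τ) (h₂ : ConsEmbeds τ σ) :
    σ = τ := by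
  obtain ⟨f, hc, hf⟩ := h₁
  obtain ⟨g, hd, -⟩ := h₂
  obtain ⟨n, r⟩ := σ
  obtain ⟨m, s⟩ := τ
  obtain rfl : n = m := le_antisymm hc.le hd.le
  have hid : ∀ i, f i = i := by
    obtain ⟨k, hk⟩ := hc
    intro i
    have hi : (i : ℕ) < n := i.isLt
    have hl : n - 1 < n := by omega
    have h₁ : (f ⟨n - 1, hl⟩ : ℕ) = k + (n - 1) := hk ⟨n - 1, hl⟩
    have h₂ : (f ⟨n - 1, hl⟩ : ℕ) < n := (f ⟨n - 1, hl⟩).isLt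
    have h₃ : (f i : ℕ) = k + i := hk i
    ext
    omega
  congr 1
  ext x y
  have := hf x y
  rw [hid, hid] at this
  exact this

/-- The consecutive embedding order. -/
instance : PartialOrder OrdEqRel where
  le := ConsEmbeds
  le_refl := ConsEmbeds.refl
  le_trans _ _ _ := ConsEmbeds.trans
  le_antisymm _ _ := ConsEmbeds.antisymm

/-- The avoidance set of `B` under the consecutive embedding order. -/
def Av (B : Finset OrdEqRel) : Set OrdEqRel :=
  {x | ∀ y ∈ B, ¬ y ≤ x}

/-- `Av B` is well quasi-ordered under the consecutive embedding order. -/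
def AvIsWQO (B : Finset OrdEqRel) : Prop :=
  WellQuasiOrderedLE (Av B)

theorem avIsWQO_iff (B : Finset OrdEqRel) :
    AvIsWQO B ↔ WellFoundedLT (Av B) ∧
      ∀ s : Set (Av B), IsAntichain (· ≤ ·) s → s.Finite :=
  wellQuasiOrderedLE_iff

/-- The equivalence relation on the positions of a word: two positions are equivalent when they
carry the same label. Words of natural numbers are the finite encoding of ordered equivalence
relations that is used as input for algorithms. -/
def ofWord (w : List ℕ) : OrdEqRel where
  len := w.length
  rel := Setoid.ker w.get

open Classical in
/-- The finite set of ordered equivalence relations encoded by a list of words. -/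
noncomputable def ofWords (l : List (List ℕ)) : Finset OrdEqRel :=
  (l.map ofWord).toFinset

theorem mem_ofWords {l : List (List ℕ)} {σ : OrdEqRel} :
    σ ∈ ofWords l ↔ ∃ w ∈ l, ofWord w = σ := by
  simp [ofWords]

theorem ofWord_surjective : Function.Surjective ofWord := by
  classical
  rintro ⟨n, r⟩
  let g : Fin n → ℕ := fun i => ((Quotient.out (Quotient.mk r i) : Fin n) : ℕ)
  have hg : ∀ i j, g i = g j ↔ r.r i j := by
    intro i j
    constructor
    · intro h
      have h' : (Quotient.mk r i).out = (Quotient.mk r j).out := Fin.ext h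
      exact Quotient.exact (Quotient.out_injective h')
    · intro h
      have h' : Quotient.mk r i = Quotient.mk r j := Quotient.sound h
      simp only [g, h']
  have hlen : (List.ofFn g).length = n := List.length_ofFn
  have hget : ∀ x y : Fin (List.ofFn g).length,
      (List.ofFn g).get x = (List.ofFn g).get y ↔ r.r (x.cast hlen) (y.cast hlen) := by
    intro x y
    rw [← hg, List.get_ofFn, List.get_ofFn]
  exact ⟨List.ofFn g, ConsEmbeds.antisymm
    ⟨Fin.cast hlen, ⟨0, fun _ => (Nat.zero_add _).symm⟩, fun x y => hget x y⟩
    ⟨Fin.cast hlen.symm, ⟨0, fun _ => (Nat.zero_add _).symm⟩, fun x y =>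
      (hget (x.cast hlen.symm) (y.cast hlen.symm)).symm⟩⟩

/-- Every finite set of ordered equivalence relations is a possible input. -/
theorem ofWords_surjective : Function.Surjective ofWords := by
  intro B
  obtain ⟨s, hs⟩ := ofWord_surjective.hasRightInverse
  refine ⟨B.toList.map s, ?_⟩
  ext σ
  simp [mem_ofWords, hs _]

/-- The maximum length of an element of `B`. -/
def maxLen (B : Finset OrdEqRel) : ℕ :=
  B.sup len

/-- The vertices of the factor graph: the members of `Av B` of length `maxLen B`. -/
abbrev FactorVertex (B : Finset OrdEqRel) : Type :=
  {μ : Setoid (Fin (maxLen B)) // (⟨maxLen B, μ⟩ : OrdEqRel) ∈ Av B}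

/-- The factor graph of `Av B`: there is an edge from `μ` to `ν` when deleting the smallest point
of `μ` gives, up to isomorphism, the same relation as deleting the largest point of `ν`. -/
def factorGraph (B : Finset OrdEqRel) : Digraph (FactorVertex B) where
  Adj μ ν := ∀ (i j : ℕ) (hi : i + 1 < maxLen B) (hj : j + 1 < maxLen B),
    μ.1.r ⟨i + 1, hi⟩ ⟨j + 1, hj⟩ ↔ ν.1.r ⟨i, by omega⟩ ⟨j, by omega⟩

/-- A vertex is special if its largest point is in a class of size one. -/
def IsSpecial {B : Finset OrdEqRel} (μ : FactorVertex B) : Prop :=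
  ∃ m : Fin (maxLen B), (∀ i, i ≤ m) ∧ ∀ i, μ.1.r i m → i = m

end OrdEqRel

namespace Digraph

variable {V : Type*} (G : Digraph V)

/-- A cycle `v₁ → v₂ → ⋯ → vₙ`: a path with at least one edge and `v₁ = vₙ`. -/
def IsCycle (c : List V) : Prop :=
  2 ≤ c.length ∧ c.IsChain G.Adj ∧ c.head? = c.getLast?

noncomputable def inDeg (v : V) : ℕ∞ :=
  {u | G.Adj u v}.encard

noncomputable def outDeg (v : V) : ℕ∞ :=
  {u | G.Adj v u}.encard

def IsInOutCycle (c : List V) : Prop :=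
  G.IsCycle c ∧ (∃ v ∈ c, 2 ≤ G.inDeg v) ∧ ∃ v ∈ c, 2 ≤ G.outDeg v

end Digraph

namespace OrdEqRel

/-- The factor graph contains an in-out cycle. -/
def HasInOutCycle (B : Finset OrdEqRel) : Prop :=
  ∃ c, (factorGraph B).IsInOutCycle c

/-- The factor graph contains a special vertex that lies on a cycle. -/
def HasSpecialOnCycle (B : Finset OrdEqRel) : Prop :=
  ∃ c, (factorGraph B).IsCycle c ∧ ∃ μ ∈ c, IsSpecial μ

end OrdEqRel

/-! Write b for `maxLen B`. The windows of length b of a long member of `Av B` form a walk in the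
factor graph, and every walk arises this way (`exists_word_of_path`). The walk need not determine
the relation: equivalences between distant positions may be invisible in the windows.

Both obstructions give bad sequences. On an in-out cycle, enter by an edge off the cycle, go round n
times and leave by another edge off it. A consecutive embedding would have to align these walks, but
the longer one still follows the cycle wherever the shorter one enters or leaves. If a special
vertex lies on a cycle, each visit can open a new class. Stopping at such a visit and identifying
the last point with a point near the start leaves all windows unchanged, and creates one equivalence
whose span grows with the word.

Conversely, without in-out cycles a walk consists of a part with unique predecessors, a part of
bounded length and a part with unique successors (`exists_path_decomposition`). Without special
vertices on cycles, a point added on the right is equivalent to a nearby earlier one; a counting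
argument gives the mirror statement on the left (`exists_eq_first_of_transGen`). So a bounded core
and the two outer lengths determine the relation (`HasCore.le`), and Dickson's lemma for pairs of
lengths with finite data gives wqo.

For decidability, vertices are coded by words of length b over b letters, and reachability is tested
by quantifying over successor-closed sets of such words, which is primitive recursive. -/

namespace Digraph

/-! ### Cycles as periodic walks and as mutual reachability. -/

variable {V : Type*} {G : Digraph V}

theorem IsCycle.exists_periodic {l : List V} (hc : G.IsCycle l) :
    ∃ L, 0 < L ∧ ∃ p : ℕ → V, (∀ i, G.Adj (p i) (p (i + 1))) ∧ (∀ i, p (i + L) = p i) ∧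
      ∀ v ∈ l, ∃ i, p i = v := by
  obtain ⟨h2, hch, hhl⟩ := hc
  have hpos : 0 < l.length - 1 := by omega
  have hltc : ∀ i, i % (l.length - 1) < l.length := fun i =>
    lt_of_lt_of_le (Nat.mod_lt _ hpos) (Nat.sub_le _ _)
  refine ⟨l.length - 1, hpos, fun i => l[i % (l.length - 1)]'(hltc i), fun i => ?_,
    fun i => by simp, ?_⟩
  · have hends : l[0]'(by omega) = l[l.length - 1]'(by omega) := by
      rw [List.head?_eq_getElem?, List.getLast?_eq_getElem?] at hhl
      rw [List.getElem?_eq_getElem (by omega), List.getElem?_eq_getElem (by omega)] at hhl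
      exact Option.some.inj hhl
    have hlt := Nat.mod_lt i hpos
    have hadj := List.isChain_iff_getElem.1 hch (i % (l.length - 1)) (by omega)
    by_cases hlast : i % (l.length - 1) + 1 = l.length - 1
    · have h0 : (i + 1) % (l.length - 1) = 0 := by
        rw [← Nat.mod_add_mod, hlast, Nat.mod_self]
      simp only [h0]
      rw [hends]
      simpa only [hlast] using hadj
    · have h1 : (i + 1) % (l.length - 1) = i % (l.length - 1) + 1 := by
        rw [← Nat.mod_add_mod, Nat.mod_eq_of_lt (by omega)]
      simpa only [h1] using hadj
  · intro v hv
    obtain ⟨i, hi, rfl⟩ := List.mem_iff_getElem.1 hv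
    by_cases hlast : i = l.length - 1
    · refine ⟨0, ?_⟩
      rw [List.head?_eq_getElem?, List.getLast?_eq_getElem?] at hhl
      rw [List.getElem?_eq_getElem (by omega), List.getElem?_eq_getElem (by omega)] at hhl
      simp only [hlast, Nat.zero_mod]
      exact Option.some.inj hhl
    · exact ⟨i, by simp only [Nat.mod_eq_of_lt (show i < l.length - 1 by omega)]⟩

theorem transGen_of_path {p : ℕ → V} {i j : ℕ} (hij : i < j)
    (hp : ∀ t, i ≤ t → t < j → G.Adj (p t) (p (t + 1))) :
    Relation.TransGen G.Adj (p i) (p j) := by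
  induction j, hij using Nat.le_induction with
  | base => exact .single (hp i le_rfl (Nat.lt_succ_self i))
  | succ j hj ih =>
    exact .tail (ih fun t h1 h2 => hp t h1 (by omega)) (hp j (by omega) (Nat.lt_succ_self j))

theorem IsCycle.transGen {l : List V} (hc : G.IsCycle l) {x y : V} (hx : x ∈ l) (hy : y ∈ l) :
    Relation.TransGen G.Adj x y := by
  obtain ⟨L, hL, p, hp, hper, hmem⟩ := hc.exists_periodic
  obtain ⟨i, rfl⟩ := hmem x hx
  obtain ⟨j, rfl⟩ := hmem y hy
  have hk : ∀ k, p (j + k * L) = p j := by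
    intro k
    induction k with
    | zero => simp
    | succ k ih => rw [Nat.succ_mul, ← Nat.add_assoc, hper, ih]
  -- With i + 1 extra turns the occurrence of `y` comes after that of `x`.
  rw [← hk (i + 1)]
  exact transGen_of_path (by nlinarith) fun t _ _ => hp t

theorem exists_isCycle {x y : V} (hxy : Relation.TransGen G.Adj x y)
    (hyx : Relation.TransGen G.Adj y x) : ∃ c, G.IsCycle c ∧ x ∈ c ∧ y ∈ c := by
  obtain ⟨z, hxz, hzy⟩ := Relation.TransGen.head'_iff.1 hxy
  obtain ⟨l₁, h₁, e₁⟩ := List.exists_isChain_cons_of_relationReflTransGen hzy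
  obtain ⟨l₂, h₂, e₂⟩ := List.exists_isChain_cons_of_relationReflTransGen hyx.to_reflTransGen
  have hy : y ∈ z :: l₁ := e₁ ▸ List.getLast_mem _
  refine ⟨x :: (z :: l₁) ++ l₂, ⟨by simp, ?_, ?_⟩, by simp, ?_⟩
  · rw [List.isChain_append]
    refine ⟨List.isChain_cons_cons.2 ⟨hxz, h₁⟩, h₂.tail, ?_⟩
    intro a ha b hb
    rw [List.getLast?_cons_cons, List.getLast?_eq_getLast_of_ne_nil (List.cons_ne_nil _ _), e₁] at ha
    obtain rfl : y = a := by simpa using ha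
    cases l₂ with
    | nil => simp at hb
    | cons b' l =>
      obtain rfl : b' = b := by simpa using hb
      exact (List.isChain_cons_cons.1 h₂).1
  · cases l₂ with
    | nil =>
      have hyx' : y = x := by simpa using e₂
      rw [List.append_nil, List.getLast?_cons_cons,
        List.getLast?_eq_getLast_of_ne_nil (List.cons_ne_nil _ _), e₁, hyx']
      rfl
    | cons b l =>
      rw [List.getLast_cons (List.cons_ne_nil _ _)] at e₂
      rw [List.getLast?_append_of_ne_nil _ (List.cons_ne_nil _ _),
        List.getLast?_eq_getLast_of_ne_nil (List.cons_ne_nil _ _), e₂]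
      rfl
  · exact List.mem_append_left _ (List.mem_cons_of_mem _ hy)

theorem two_le_inDeg_iff {v : V} :
    2 ≤ G.inDeg v ↔ ∃ a b, G.Adj a v ∧ G.Adj b v ∧ a ≠ b := by
  rw [inDeg, ← one_add_one_eq_two, ENat.add_one_le_iff ENat.one_ne_top, Set.one_lt_encard_iff]
  rfl

theorem two_le_outDeg_iff {v : V} :
    2 ≤ G.outDeg v ↔ ∃ a b, G.Adj v a ∧ G.Adj v b ∧ a ≠ b := by
  rw [outDeg, ← one_add_one_eq_two, ENat.add_one_le_iff ENat.one_ne_top, Set.one_lt_encard_iff]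
  rfl

end Digraph

/-! ### Labellings, windows and vertices of the factor graph. -/

namespace OrdEqRel

/-- The ordered equivalence relation on `{0, …, n - 1}` induced by a labelling of the positions. -/
def ofFun (n : ℕ) (w : ℕ → ℕ) : OrdEqRel where
  len := n
  rel := Setoid.ker fun i : Fin n => w i

theorem ofWord_eq_ofFun (u : List ℕ) : ofWord u = ofFun u.length fun i => u.getD i 0 := by
  unfold ofWord ofFun
  congr 1
  ext x y
  simp [Setoid.ker_def]

theorem exists_eq_ofFun (σ : OrdEqRel) : ∃ w, σ = ofFun σ.len w := by
  obtain ⟨u, rfl⟩ := ofWord_surjective σ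
  exact ⟨_, ofWord_eq_ofFun u⟩

theorem ofFun_le_ofFun {n m : ℕ} {v w : ℕ → ℕ} : ofFun n v ≤ ofFun m w ↔
    ∃ k, k + n ≤ m ∧ ∀ i < n, ∀ j < n, (v i = v j ↔ w (k + i) = w (k + j)) := by
  constructor
  · rintro ⟨f, ⟨k, hk⟩, hf⟩
    rcases Nat.eq_zero_or_pos n with rfl | hn
    · exact ⟨0, by simp, by simp⟩
    · refine ⟨k, ?_, fun i hi j hj => ?_⟩
      · have h1 : (f ⟨n - 1, by simp only [ofFun]; omega⟩ : ℕ) = k + (n - 1) := hk _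
        have h2 : (f ⟨n - 1, by simp only [ofFun]; omega⟩ : ℕ) < m := (f _).isLt
        omega
      · have h1 : v i = v j ↔ w (f ⟨i, hi⟩) = w (f ⟨j, hj⟩) := hf ⟨i, hi⟩ ⟨j, hj⟩
        rwa [hk ⟨i, hi⟩, hk ⟨j, hj⟩] at h1
  · rintro ⟨k, hk, h⟩
    refine ⟨fun i => ⟨k + i, lt_of_lt_of_le (Nat.add_lt_add_left i.isLt k) hk⟩,
      ⟨k, fun i => rfl⟩, fun x y => ?_⟩
    exact h x x.isLt y y.isLt

variable {B : Finset OrdEqRel}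

theorem mem_Av_of_le {σ τ : OrdEqRel} (h : σ ≤ τ) (hτ : τ ∈ Av B) : σ ∈ Av B :=
  fun y hy hyσ => hτ y hy (hyσ.trans h)

theorem shift_mem_Av {n t m : ℕ} {w : ℕ → ℕ} (h : ofFun n w ∈ Av B) (ht : t + m ≤ n) :
    ofFun m (fun i => w (t + i)) ∈ Av B :=
  mem_Av_of_le (ofFun_le_ofFun.2 ⟨t, ht, fun _ _ _ _ => Iff.rfl⟩) h

theorem len_le_maxLen {σ : OrdEqRel} (h : σ ∈ B) : σ.len ≤ maxLen B :=
  Finset.le_sup (f := len) h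

theorem mem_Av_of_windows {n : ℕ} {w : ℕ → ℕ} (hn : maxLen B ≤ n)
    (h : ∀ t, t + maxLen B ≤ n → ofFun (maxLen B) (fun i => w (t + i)) ∈ Av B) :
    ofFun n w ∈ Av B := by
  intro y hy hle
  obtain ⟨v, hv⟩ := exists_eq_ofFun y
  have hlen := len_le_maxLen hy
  rw [hv, ofFun_le_ofFun] at hle
  obtain ⟨k, hk, hvw⟩ := hle
  -- The window starts where the forbidden occurrence does, moved left if it would overrun the end.
  have hmin : min k (n - maxLen B) + (k - min k (n - maxLen B)) = k := by omega
  refine h (min k (n - maxLen B)) (by omega) y hy ?_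
  rw [hv, ofFun_le_ofFun]
  refine ⟨k - min k (n - maxLen B), by omega, fun i hi j hj => ?_⟩
  rw [hvw i hi j hj, ← Nat.add_assoc, ← Nat.add_assoc, hmin]

/-- The labelling `u` of the positions induces the vertex `μ` of the factor graph. -/
def Represents (u : ℕ → ℕ) (μ : FactorVertex B) : Prop :=
  ∀ (i j : ℕ) (hi : i < maxLen B) (hj : j < maxLen B), μ.1.r ⟨i, hi⟩ ⟨j, hj⟩ ↔ u i = u j

theorem exists_vertex {u : ℕ → ℕ} (h : ofFun (maxLen B) u ∈ Av B) :
    ∃ μ : FactorVertex B, Represents u μ :=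
  ⟨⟨Setoid.ker fun i : Fin (maxLen B) => u i, h⟩, fun _ _ _ _ => Iff.rfl⟩

theorem Represents.congr {u v : ℕ → ℕ} {μ : FactorVertex B} (h : Represents u μ)
    (huv : ∀ i < maxLen B, ∀ j < maxLen B, (u i = u j ↔ v i = v j)) : Represents v μ :=
  fun i j hi hj => (h i j hi hj).trans (huv i hi j hj)

theorem Represents.ofFun_eq {u : ℕ → ℕ} {μ : FactorVertex B} (h : Represents u μ) :
    ofFun (maxLen B) u = ⟨maxLen B, μ.1⟩ := by
  unfold ofFun
  congr 1
  ext x y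
  exact (h x y x.2 y.2).symm

theorem Represents.mem_Av {u : ℕ → ℕ} {μ : FactorVertex B} (h : Represents u μ) :
    ofFun (maxLen B) u ∈ Av B :=
  h.ofFun_eq ▸ μ.2

theorem exists_represents (μ : FactorVertex B) : ∃ u, Represents u μ := by
  obtain ⟨w, hw⟩ := exists_eq_ofFun ⟨maxLen B, μ.1⟩
  refine ⟨w, fun i j hi hj => ?_⟩
  have h : μ.1 = Setoid.ker fun i : Fin (maxLen B) => w i := by
    simpa [ofFun] using hw
  rw [h]
  rfl

theorem Represents.eq_iff {u v : ℕ → ℕ} {μ ν : FactorVertex B} (hu : Represents u μ)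
    (hv : Represents v ν) :
    μ = ν ↔ ∀ i < maxLen B, ∀ j < maxLen B, (u i = u j ↔ v i = v j) := by
  constructor
  · rintro rfl i hi j hj
    rw [← hu i j hi hj, hv i j hi hj]
  · intro h
    ext x y
    exact (hu x y x.2 y.2).trans ((h x x.2 y y.2).trans (hv x y x.2 y.2).symm)

theorem Represents.adj_iff {u v : ℕ → ℕ} {μ ν : FactorVertex B} (hu : Represents u μ)
    (hv : Represents v ν) : (factorGraph B).Adj μ ν ↔
      ∀ i j, i + 1 < maxLen B → j + 1 < maxLen B → (u (i + 1) = u (j + 1) ↔ v i = v j) := by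
  refine forall_congr' fun i => forall_congr' fun j => forall_congr' fun hi =>
    forall_congr' fun hj => ?_
  rw [← hu (i + 1) (j + 1) hi hj, ← hv i j (by omega) (by omega)]

theorem Represents.isSpecial_iff {u : ℕ → ℕ} {μ : FactorVertex B} (hu : Represents u μ)
    (hb : 0 < maxLen B) :
    IsSpecial μ ↔ ∀ i, i + 1 < maxLen B → u i ≠ u (maxLen B - 1) := by
  have hlast : maxLen B - 1 < maxLen B := by omega
  constructor
  · rintro ⟨m, hm, hs⟩ i hi heq
    have h1 : maxLen B - 1 ≤ m := hm ⟨_, hlast⟩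
    have h2 : m = ⟨maxLen B - 1, hlast⟩ := by
      ext
      have := m.2
      simp only
      omega
    subst h2
    have := Fin.ext_iff.1 (hs ⟨i, by omega⟩ ((hu _ _ _ _).2 heq))
    simp only at this
    omega
  · intro h
    refine ⟨⟨maxLen B - 1, hlast⟩, fun i => Fin.le_def.2 (by have := i.2; simp only; omega),
      fun i hi => ?_⟩
    by_contra hne
    refine h i ?_ ((hu i _ i.2 hlast).1 hi)
    have := i.2
    have : (i : ℕ) ≠ maxLen B - 1 := fun h => hne (Fin.ext h)
    omega

end OrdEqRel

/-! ### Realising a walk by a labelling. -/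

namespace OrdEqRel

section PathWord

variable (b : ℕ) (g : ℕ → ℕ → ℕ)

open Classical in
/-- The labelling of `ℕ` whose window of length `b` at `t` is to carry the labelling `g t`, and in
which a position equivalent to none of the `b - 1` preceding ones starts a new class. -/
noncomputable def pathWord (q : ℕ) : ℕ :=
  if h : ∃ i, q + 1 - b ≤ i ∧ i < q ∧ g (q + 1 - b) (i - (q + 1 - b)) =
      g (q + 1 - b) (q - (q + 1 - b)) then
    pathWord h.choose
  else q
termination_by q
decreasing_by exact h.choose_spec.2.1

/-- Consecutive labellings agree on the common part of their windows. -/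
def Compatible (t : ℕ) : Prop :=
  ∀ i j, i + 1 < b → j + 1 < b → (g t (i + 1) = g t (j + 1) ↔ g (t + 1) i = g (t + 1) j)

variable {b g}

theorem pathWord_le (q : ℕ) : pathWord b g q ≤ q := by
  induction q using Nat.strong_induction_on with
  | _ q ih =>
    rw [pathWord]
    split_ifs with h
    · exact (ih _ h.choose_spec.2.1).trans h.choose_spec.2.1.le
    · exact le_rfl

theorem pathWord_cases (q : ℕ) :
    (∃ i, q + 1 - b ≤ i ∧ i < q ∧ g (q + 1 - b) (i - (q + 1 - b)) =
      g (q + 1 - b) (q - (q + 1 - b)) ∧ pathWord b g q = pathWord b g i) ∨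
    ((∀ i, q + 1 - b ≤ i → i < q → g (q + 1 - b) (i - (q + 1 - b)) ≠
      g (q + 1 - b) (q - (q + 1 - b))) ∧ pathWord b g q = q) := by
  by_cases h : ∃ i, q + 1 - b ≤ i ∧ i < q ∧ g (q + 1 - b) (i - (q + 1 - b)) =
      g (q + 1 - b) (q - (q + 1 - b))
  · refine .inl ⟨h.choose, h.choose_spec.1, h.choose_spec.2.1, h.choose_spec.2.2, ?_⟩
    rw [pathWord, dif_pos h]
  · refine .inr ⟨fun i h1 h2 h3 => h ⟨i, h1, h2, h3⟩, ?_⟩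
    rw [pathWord, dif_neg h]

/-- A label is either copied from within the window or equal to its own position, and the latter
exceeds all earlier labels. -/
theorem pathWord_fresh {q : ℕ} (h : ∀ i < q, q + 1 ≤ i + b → pathWord b g i ≠ pathWord b g q) :
    ∀ i < q, pathWord b g i ≠ pathWord b g q := by
  rcases pathWord_cases (b := b) (g := g) q with ⟨i, h1, h2, -, h4⟩ | ⟨-, h2⟩
  · exact absurd h4.symm (h i h2 (by omega))
  · intro i hi
    rw [h2]
    exact ((pathWord_le i).trans_lt hi).ne

/-- Positions common to windows `s` and `t` lie in every window between, so compatibility can be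
chained. -/
theorem Compatible.transfer {s t x y : ℕ} (hst : s ≤ t) (h : ∀ r, s ≤ r → r < t → Compatible b g r)
    (htx : t ≤ x) (hty : t ≤ y) (hx : x < s + b) (hy : y < s + b) :
    g s (x - s) = g s (y - s) ↔ g t (x - t) = g t (y - t) := by
  induction t, hst using Nat.le_induction with
  | base => rfl
  | succ t hst ih =>
    rw [ih (fun r h1 h2 => h r h1 (by omega)) (by omega) (by omega)]
    have := h t hst (Nat.lt_succ_self t) (x - (t + 1)) (y - (t + 1)) (by omega) (by omega)
    rwa [show x - (t + 1) + 1 = x - t by omega, show y - (t + 1) + 1 = y - t by omega] at this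

/-- Only the last point of a window needs checking: earlier pairs were settled in earlier windows
and carry over by `Compatible.transfer`. The truncated subtraction makes the first b points all use
window 0. -/
theorem pathWord_eq_iff_last (q : ℕ) (h : ∀ s < q + 1 - b, Compatible b g s) :
    ∀ i ≤ q, q + 1 - b ≤ i → (pathWord b g i = pathWord b g q ↔
      g (q + 1 - b) (i - (q + 1 - b)) = g (q + 1 - b) (q - (q + 1 - b))) := by
  induction q using Nat.strong_induction_on with
  | _ q ih =>
    have key : ∀ i < q, ∀ j < q, q + 1 - b ≤ i → q + 1 - b ≤ j → i ≤ j →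
        (pathWord b g i = pathWord b g j ↔
          g (q + 1 - b) (i - (q + 1 - b)) = g (q + 1 - b) (j - (q + 1 - b))) := by
      intro i hi j hj hti htj hij
      rw [ih j hj (fun s hs => h s (by omega)) i hij (by omega)]
      exact Compatible.transfer (by omega) (fun r _ hr => h r hr) hti htj (by omega) (by omega)
    intro i hi hti
    rcases hi.eq_or_lt with rfl | hi
    · simp
    rcases pathWord_cases (b := b) (g := g) q with ⟨k, h1, h2, h3, h4⟩ | ⟨h1, h2⟩
    · rw [h4, ← h3]
      rcases le_total i k with hik | hik
      · exact key i hi k h2 hti h1 hik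
      · rw [eq_comm, key k h2 i hi h1 hti hik, eq_comm]
    · rw [h2]
      exact iff_of_false ((pathWord_le i).trans_lt hi).ne (h1 i hti hi)

theorem pathWord_eq_iff {t : ℕ} (h : ∀ s < t, Compatible b g s) {i j : ℕ} (hi : i < b)
    (hj : j < b) : pathWord b g (t + i) = pathWord b g (t + j) ↔ g t i = g t j := by
  wlog hij : i ≤ j generalizing i j
  · rw [eq_comm, this hj hi (by omega), eq_comm]
  rw [pathWord_eq_iff_last (t + j) (fun s hs => h s (by omega)) (t + i) (by omega) (by omega),
    Compatible.transfer (t := t) (by omega) (fun r _ hr => h r hr) (by omega) (by omega)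
      (by omega) (by omega)]
  simp

end PathWord

variable {B : Finset OrdEqRel}

/-- Every path in the factor graph is the sequence of windows of a labelling of `ℕ`, in which every
position is equivalent to a nearby earlier one or to no earlier one at all. -/
theorem exists_word_of_path (p : ℕ → FactorVertex B) : ∃ w : ℕ → ℕ,
    (∀ t, (∀ s < t, (factorGraph B).Adj (p s) (p (s + 1))) →
      Represents (fun i => w (t + i)) (p t)) ∧
    ∀ q, (∀ i < q, q + 1 ≤ i + maxLen B → w i ≠ w q) → ∀ i < q, w i ≠ w q := by
  choose g hg using fun t => exists_represents (p t)
  refine ⟨pathWord (maxLen B) g, fun t ht => ?_, fun q => pathWord_fresh⟩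
  refine (hg t).congr fun i hi j hj => (pathWord_eq_iff (fun s hs => ?_) hi hj).symm
  exact ((hg s).adj_iff (hg (s + 1))).1 (ht s hs)

end OrdEqRel

/-! ### Necessity: bad sequences from the two obstructions. -/

namespace OrdEqRel

variable {B : Finset OrdEqRel}

theorem not_avIsWQO_of_badSequence (n : ℕ → ℕ) (w : ℕ → ℕ → ℕ)
    (hAv : ∀ i, ofFun (n i) (w i) ∈ Av B)
    (hbad : ∀ i j, i < j → ¬ ofFun (n i) (w i) ≤ ofFun (n j) (w j)) : ¬ AvIsWQO B := by
  intro h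
  obtain ⟨i, j, hij, hle⟩ := h.wqo fun i => (⟨_, hAv i⟩ : Av B)
  exact hbad i j hij hle

/-- The relations in which only the first and last points are equivalent form an infinite antichain.
-/
theorem not_avIsWQO_empty : ¬ AvIsWQO ∅ := by
  refine not_avIsWQO_of_badSequence (fun n => n + 2) (fun n i => i % (n + 1))
    (fun i => by simp [Av]) ?_
  intro n m hnm hle
  obtain ⟨k, hk, h⟩ := ofFun_le_ofFun.1 hle
  have h0 := (h 0 (by omega) (n + 1) (by omega)).1 (by simp)
  have h1 : k ≡ k + (n + 1) [MOD m + 1] := h0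
  have h2 := (Nat.modEq_iff_dvd' (by omega)).1 h1
  rw [Nat.add_sub_cancel_left] at h2
  have := Nat.le_of_dvd (by omega) h2
  omega

theorem not_avIsWQO_of_hasInOutCycle (h : HasInOutCycle B) :
    ¬ AvIsWQO B := by
  obtain ⟨l, hl, ⟨x, hx, hx2⟩, ⟨y, hy, hy2⟩⟩ := h
  obtain ⟨L, hL, p₀, hp₀, hper₀, hmem₀⟩ := hl.exists_periodic
  obtain ⟨r, rfl⟩ := hmem₀ x hx
  obtain ⟨s₀, rfl⟩ := hmem₀ y hy
  obtain ⟨p, hp, hper, hpx, s, hps⟩ : ∃ p : ℕ → FactorVertex B,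
      (∀ i, (factorGraph B).Adj (p i) (p (i + 1))) ∧ (∀ i, p (i + L) = p i) ∧ p 0 = p₀ r ∧
      ∃ s, p s = p₀ s₀ := by
    -- Rotate the cycle to start at the vertex with two predecessors; adding r turns keeps the
    -- subtraction of r honest.
    refine ⟨fun i => p₀ (r + i), fun i => hp₀ _,
      fun i => (by simp only [← Nat.add_assoc, hper₀]), rfl, s₀ + r * L - r, ?_⟩
    have hk : ∀ k, p₀ (s₀ + k * L) = p₀ s₀ := by
      intro k
      induction k with
      | zero => simp
      | succ k ih => rw [Nat.succ_mul, ← Nat.add_assoc, hper₀, ih]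
    have : r ≤ r * L := Nat.le_mul_of_pos_right r hL
    simp only [show r + (s₀ + r * L - r) = s₀ + r * L by omega, hk]
  have hk : ∀ i k, p (i + k * L) = p i := by
    intro i k
    induction k with
    | zero => simp
    | succ k ih => rw [Nat.succ_mul, ← Nat.add_assoc, hper, ih]
  rw [← hpx] at hx2
  rw [← hps] at hy2
  obtain ⟨u, hu, hne⟩ : ∃ u, (factorGraph B).Adj u (p 0) ∧ u ≠ p (L - 1) := by
    obtain ⟨a, b, ha, hb, hab⟩ := Digraph.two_le_inDeg_iff.1 hx2
    by_cases h : a = p (L - 1)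
    · exact ⟨b, hb, fun h' => hab (h.trans h'.symm)⟩
    · exact ⟨a, ha, h⟩
  obtain ⟨z, hz, hnz⟩ : ∃ z, (factorGraph B).Adj (p s) z ∧ z ≠ p (s + 1) := by
    obtain ⟨a, b, ha, hb, hab⟩ := Digraph.two_le_outDeg_iff.1 hy2
    by_cases h : a = p (s + 1)
    · exact ⟨b, hb, fun h' => hab (h.trans h'.symm)⟩
    · exact ⟨a, ha, h⟩
  -- Enter from `u`, make n turns, continue to the branching vertex `p s`, and exit to `z`.
  let P : ℕ → ℕ → FactorVertex B := fun n t =>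
    if t = 0 then u else if t ≤ n * L + s + 1 then p (t - 1) else z
  have hP0 : ∀ n, P n 0 = u := fun n => if_pos rfl
  have hPp : ∀ n t, t ≤ n * L + s → P n (t + 1) = p t := fun n t ht => by
    simp only [P, if_neg (Nat.succ_ne_zero t), if_pos (show t + 1 ≤ n * L + s + 1 by omega)]
    rfl
  have hPz : ∀ n, P n (n * L + s + 2) = z := fun n => by
    simp only [P]
    rw [if_neg (by omega), if_neg (by omega)]
  have hPadj : ∀ n t, t < n * L + s + 2 → (factorGraph B).Adj (P n t) (P n (t + 1)) := by
    intro n t ht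
    rcases t with _ | t
    · rw [hP0, hPp n 0 (by omega)]
      exact hu
    · rw [hPp n t (by omega)]
      rcases Nat.lt_or_ge t (n * L + s) with h | h
      · rw [hPp n (t + 1) (by omega)]
        exact hp t
      · obtain rfl : t = n * L + s := by omega
        rw [hPz, Nat.add_comm, hk]
        exact hz
  choose w hw _ using fun n => exists_word_of_path (P n)
  have hwin : ∀ n t, t ≤ n * L + s + 2 → Represents (fun i => w n (t + i)) (P n t) :=
    fun n t ht => hw n t fun r hr => hPadj n r (by omega)
  refine not_avIsWQO_of_badSequence (fun n => (n + 1) * L + s + 2 + maxLen B) (fun n => w (n + 1))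
    (fun n => mem_Av_of_windows (by omega) fun t ht => (hwin _ t (by omega)).mem_Av) ?_
  intro n m hnm hle
  have hnmL : (n + 1) * L + L ≤ (m + 1) * L := by
    rw [← Nat.succ_mul]
    exact Nat.mul_le_mul_right L (by omega)
  have hLn : L ≤ (n + 1) * L := Nat.le_mul_of_pos_left L (by omega)
  obtain ⟨k, hk1, h⟩ := ofFun_le_ofFun.1 hle
  have heq : ∀ t ≤ (n + 1) * L + s + 2, P (n + 1) t = P (m + 1) (k + t) := by
    intro t ht
    rw [(hwin (n + 1) t ht).eq_iff (hwin (m + 1) (k + t) (by omega))]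
    intro i hi j hj
    rw [h (t + i) (by omega) (t + j) (by omega), Nat.add_assoc, Nat.add_assoc]
  -- With shift 0 the short walk's exit `z` meets `p (s + 1)` in the longer walk. With a positive
  -- shift, its entrance `u` and the vertex `p (L - 1)` one turn later meet equal vertices of the
  -- periodic part. At least one turn is needed here, hence the index n + 1.
  rcases k with _ | k
  · have h1 := heq _ le_rfl
    rw [hPz, Nat.zero_add, hPp (m + 1) ((n + 1) * L + s + 1) (by omega),
      show (n + 1) * L + s + 1 = s + 1 + (n + 1) * L by omega, hk] at h1
    exact hnz h1
  · have h1 := heq 0 (by omega)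
    rw [hP0, Nat.add_zero, hPp (m + 1) k (by omega)] at h1
    have h2 := heq (L - 1 + 1) (by omega)
    rw [hPp (n + 1) (L - 1) (by omega), ← Nat.add_assoc, hPp (m + 1) _ (by omega),
      show k + 1 + (L - 1) = k + L by omega, hper] at h2
    exact hne (h1.trans h2.symm)

theorem not_avIsWQO_of_hasSpecialOnCycle (hb : 0 < maxLen B) (h : HasSpecialOnCycle B) :
    ¬ AvIsWQO B := by
  obtain ⟨l, hl, x, hx, hxs⟩ := h
  obtain ⟨L, hL, p₀, hp₀, hper₀, hmem₀⟩ := hl.exists_periodic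
  obtain ⟨r, rfl⟩ := hmem₀ x hx
  obtain ⟨w, hw, hfresh⟩ := exists_word_of_path fun i => p₀ (r + i)
  replace hw := fun t => hw t fun s _ => hp₀ (r + s)
  have hper : ∀ k, p₀ (r + k * L) = p₀ r := by
    intro k
    induction k with
    | zero => simp
    | succ k ih => rw [Nat.succ_mul, ← Nat.add_assoc, hper₀, ih]
  let Q : ℕ → ℕ := fun n => n * L + (maxLen B - 1)
  have hQlt : ∀ n m, n < m → Q n < Q m := fun n m hnm =>
    Nat.add_lt_add_right (Nat.mul_lt_mul_of_pos_right hnm hL) _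
  have hspec : ∀ n i, i + 1 < maxLen B → w (n * L + i) ≠ w (Q n) := by
    intro n i hi
    have h1 := hw (n * L)
    simp only [hper] at h1
    exact (h1.isSpecial_iff hb).1 hxs i hi
  have hQ : ∀ n, ∀ i < Q n, w i ≠ w (Q n) := by
    refine fun n => hfresh (Q n) fun i hi hi2 => ?_
    have h1 : Q n = n * L + (maxLen B - 1) := rfl
    have := hspec n (i - n * L) (by omega)
    rwa [Nat.add_sub_of_le (by omega)] at this
  have hQinj : ∀ n m, w (Q n) = w (Q m) → n = m := by
    intro n m h
    rcases lt_trichotomy n m with h1 | h1 | h1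
    · exact absurd h (hQ m _ (hQlt n m h1))
    · exact h1
    · exact absurd h.symm (hQ n _ (hQlt m n h1))
  -- Pigeonhole: b distinct labels cannot all occur among b - 1 positions.
  have hdead : ∀ n, ∃ j < maxLen B, ∀ i, i + 1 < maxLen B → w (n * L + i) ≠ w (Q j) := by
    intro n
    by_contra! hcon
    have hsub : (Finset.range (maxLen B)).image (fun j => w (Q j)) ⊆
        (Finset.range (maxLen B - 1)).image fun i => w (n * L + i) := by
      intro v hv
      obtain ⟨j, hj, rfl⟩ := Finset.mem_image.1 hv
      obtain ⟨i, hi, he⟩ := hcon j (Finset.mem_range.1 hj)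
      exact Finset.mem_image.2 ⟨i, Finset.mem_range.2 (by omega), he⟩
    have h1 := Finset.card_le_card hsub
    rw [Finset.card_image_of_injective _ fun n m h => hQinj n m h, Finset.card_range] at h1
    have h2 := h1.trans Finset.card_image_le
    rw [Finset.card_range] at h2
    omega
  choose j hjb hj using hdead
  -- The last point `Q n` joins an old class absent from the rest of its window, so it still looks
  -- isolated there and no window changes type.
  let W : ℕ → ℕ → ℕ := fun n => Function.update w (Q n) (w (Q (j n)))
  have hWlt : ∀ n i, i < Q n → W n i = w i := fun n i hi => Function.update_of_ne hi.ne _ _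
  have hWQ : ∀ n, W n (Q n) = w (Q (j n)) := fun n => Function.update_self _ _ _
  have hwin : ∀ n t, t ≤ n * L → Represents (fun i => W n (t + i)) (p₀ (r + t)) := by
    intro n t ht
    refine (hw t).congr ?_
    suffices H : ∀ i < maxLen B, ∀ k < maxLen B, i < k →
        (w (t + i) = w (t + k) ↔ W n (t + i) = W n (t + k)) by
      intro i hi k hk
      rcases lt_trichotomy i k with h | rfl | h
      · exact H i hi k hk h
      · simp
      · rw [eq_comm, H k hk i hi h, eq_comm]
    intro i hi k hk hik
    have hQn : Q n = n * L + (maxLen B - 1) := rfl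
    rw [hWlt n (t + i) (by omega)]
    rcases Nat.lt_or_ge (t + k) (Q n) with h | h
    · rw [hWlt n (t + k) h]
    · have h1 : t + k = Q n := by omega
      obtain rfl : t = n * L := by omega
      rw [h1, hWQ]
      exact iff_of_false (hspec n i (by omega)) (hj n i (by omega))
  -- Multiples of b keep the indices at least b apart, while every `j n` is below b.
  refine not_avIsWQO_of_badSequence (fun n => Q ((n + 1) * maxLen B) + 1)
    (fun n => W ((n + 1) * maxLen B)) (fun n => mem_Av_of_windows ?_ fun t ht =>
      (hwin _ t ?_).mem_Av) ?_
  · simp only [Q]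
    omega
  · simp only [Q] at ht
    omega
  intro n m hnm hle
  have hN : (n + 1) * maxLen B + maxLen B ≤ (m + 1) * maxLen B := by
    rw [← Nat.succ_mul]
    exact Nat.mul_le_mul_right _ (by omega)
  have hNb : maxLen B ≤ (n + 1) * maxLen B := Nat.le_mul_of_pos_left _ (by omega)
  generalize (n + 1) * maxLen B = N at *
  generalize (m + 1) * maxLen B = M at *
  obtain ⟨k, hk1, h⟩ := ofFun_le_ofFun.1 hle
  have hjN : Q (j N) < Q N := hQlt _ _ (by have := hjb N; omega)
  have hQN : Q N = N * L + (maxLen B - 1) := rfl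
  have hQM : Q M = M * L + (maxLen B - 1) := rfl
  have h1 : W M (k + Q (j N)) = W M (k + Q N) := by
    rw [← h _ (by omega) _ (by omega), hWlt N _ hjN, hWQ]
  have h2 : ∀ i < Q N, Q N + 1 ≤ i + maxLen B → W M (k + i) ≠ W M (k + Q N) := by
    intro i hi hi2
    rw [Ne, ← h _ (by omega) _ (by omega), hWlt N _ hi, hWQ]
    have := hj N (i - N * L) (by omega)
    rwa [Nat.add_sub_of_le (by omega)] at this
  rw [hWlt M (k + Q (j N)) (by omega)] at h1
  -- If the image of the last point is interior, it repeats a distant label but no nearby one,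
  -- against `hfresh`. If it is the last point, comparing partners gives `j M = M - N + j N`, which
  -- is at least b.
  rcases Nat.lt_or_ge (k + Q N) (Q M) with hlt | hge
  · rw [hWlt M _ hlt] at h1
    refine hfresh (k + Q N) ?_ (k + Q (j N)) (by omega) h1
    intro i hi hi2
    have := h2 (i - k) (by omega) (by omega)
    rwa [Nat.add_sub_of_le (by omega), hWlt M _ (by omega), hWlt M _ hlt] at this
  · have hkeq : k + Q N = Q M := by omega
    have hk2 : k = (M - N) * L := by
      rw [Nat.sub_mul]
      omega
    have h3 : k + Q (j N) = Q (M - N + j N) := by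
      simp only [Q, hk2]
      ring
    rw [hkeq, hWQ, h3] at h1
    have h4 := hQinj _ _ h1
    have := hjb M
    omega

end OrdEqRel

/-! ### Walks in a finite digraph without in-out cycles. -/

namespace Digraph

variable {V : Type*} {G : Digraph V}

/-- In a finite digraph without in-out cycles every path consists of a part inside a cycle without
alternative entrances, a part of bounded length, and a part inside a cycle without alternative
exits. -/
theorem exists_path_decomposition [Finite V]
    (hG : ∀ x y, Relation.TransGen G.Adj x y → Relation.TransGen G.Adj y x →
      ¬ (2 ≤ G.inDeg x ∧ 2 ≤ G.outDeg y))
    {n : ℕ} (hn : 0 < n) {p : ℕ → V} (hp : ∀ t, t + 1 < n → G.Adj (p t) (p (t + 1))) :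
    ∃ a < n,
      (∀ t < a, Relation.TransGen G.Adj (p t) (p t) ∧
        ∀ u v, G.Adj u (p (t + 1)) → G.Adj v (p (t + 1)) → u = v) ∧
      ∀ t, a + (Nat.card V + 1) ≤ t → t + 1 < n →
        Relation.TransGen G.Adj (p (t + 1)) (p (t + 1)) ∧
        ∀ u v, G.Adj (p t) u → G.Adj (p t) v → u = v := by
  classical
  let T := Relation.TransGen G.Adj
  -- `I` and `O`: the strong component of `x` contains a cycle through `x`, and all its vertices
  -- have at most one predecessor, respectively successor, in the whole graph. `I` propagates
  -- backwards along edges and `O` forwards.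
  let I : V → Prop := fun x => T x x ∧ ∀ y, T x y → T y x →
    ∀ u v, G.Adj u y → G.Adj v y → u = v
  let O : V → Prop := fun x => T x x ∧ ∀ y, T x y → T y x →
    ∀ u v, G.Adj y u → G.Adj y v → u = v
  have hdich : ∀ x, T x x → I x ∨ O x := by
    intro x hx
    by_contra! h
    obtain ⟨hI, hO⟩ := h
    obtain ⟨y, h1, h2, u, v, h3, h4, h5⟩ : ∃ y, T x y ∧ T y x ∧ ∃ u v, G.Adj u y ∧ G.Adj v y ∧
        u ≠ v := by
      by_contra! hc
      exact hI ⟨hx, fun y h1 h2 u v => hc y h1 h2 u v⟩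
    obtain ⟨z, h1', h2', u', v', h3', h4', h5'⟩ : ∃ y, T x y ∧ T y x ∧ ∃ u v, G.Adj y u ∧
        G.Adj y v ∧ u ≠ v := by
      by_contra! hc
      exact hO ⟨hx, fun y h1 h2 u v => hc y h1 h2 u v⟩
    exact hG y z (h2.trans h1') (h2'.trans h1)
      ⟨two_le_inDeg_iff.2 ⟨u, v, h3, h4, h5⟩, two_le_outDeg_iff.2 ⟨u', v', h3', h4', h5'⟩⟩
  have hIback : ∀ x y, G.Adj x y → I y → I x := by
    rintro x y hxy ⟨hy, hu⟩
    obtain ⟨z, hyz, hzy⟩ := Relation.TransGen.tail'_iff.1 hy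
    obtain rfl : z = x := hu y hy hy z x hzy hxy
    refine ⟨.head' hxy hyz, fun t h1 h2 => hu t ?_ (h2.tail hxy)⟩
    exact Relation.TransGen.trans_right hyz h1
  have hOfwd : ∀ x y, G.Adj x y → O x → O y := by
    rintro x y hxy ⟨hx, hu⟩
    obtain ⟨z, hxz, hzx⟩ := Relation.TransGen.head'_iff.1 hx
    obtain rfl : z = y := hu x hx hx z y hxz hxy
    refine ⟨.tail' hzx hxy, fun t h1 h2 => hu t (.head hxy h1) ?_⟩
    exact Relation.TransGen.trans_left h2 hzx
  -- The last time in `I`; the default 0 is harmless, as the first part is then empty.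
  let a := Nat.findGreatest (fun t => I (p t)) (n - 1)
  have han : a ≤ n - 1 := Nat.findGreatest_le _
  refine ⟨a, by omega, ?_, ?_⟩
  · have hIa : ∀ t, 0 < a → t ≤ a → I (p t) := by
      intro t ha hta
      induction hta using Nat.decreasingInduction with
      | self => exact Nat.findGreatest_of_ne_zero rfl ha.ne'
      | of_succ k hk ih => exact hIback _ _ (hp k (by omega)) ih
    intro t ht
    have h1 := hIa (t + 1) (by omega) ht
    exact ⟨(hIa t (by omega) ht.le).1, h1.2 _ h1.1 h1.1⟩
  · intro t hat htn
    have hOt : O (p t) := by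
      -- A vertex repeated after time `a` lies on a cycle and is not in `I`, hence is in `O`.
      have hninj : ¬ Function.Injective fun i : Fin (Nat.card V + 1) => p (a + 1 + i) := by
        intro hinj
        have := Nat.card_le_card_of_injective _ hinj
        rw [Nat.card_fin] at this
        omega
      obtain ⟨i, j, hij, hij'⟩ : ∃ i j : Fin (Nat.card V + 1), p (a + 1 + i) = p (a + 1 + j) ∧
          i < j := by
        obtain ⟨i, j, h, hne⟩ := Function.not_injective_iff.1 hninj
        rcases lt_or_gt_of_ne hne with h1 | h1
        · exact ⟨i, j, h, h1⟩
        · exact ⟨j, i, h.symm, h1⟩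
      have hi := i.2
      have hj := j.2
      have hlt : (i : ℕ) < j := hij'
      have hT : T (p (a + 1 + i)) (p (a + 1 + i)) := by
        conv => arg 2; rw [hij]
        exact transGen_of_path (by omega) fun s _ hs => hp s (by omega)
      have hO : O (p (a + 1 + i)) := by
        refine (hdich _ hT).resolve_left fun hI => ?_
        have := Nat.le_findGreatest (P := fun t => I (p t)) (n := n - 1) (m := a + 1 + i)
          (by omega) hI
        omega
      have hle : a + 1 + i ≤ t := by omega
      clear hat
      induction t, hle using Nat.le_induction with
      | base => exact hO
      | succ s hs ih => exact hOfwd _ _ (hp s (by omega)) (ih (by omega))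
    exact ⟨(hOfwd _ _ (hp t htn) hOt).1, hOt.2 _ hOt.1 hOt.1⟩

end Digraph

theorem Finset.card_image_le_of_factors {α β γ : Type*} [DecidableEq β] [DecidableEq γ]
    {s : Finset α} {f : α → β} {g : α → γ} (h : ∀ i ∈ s, ∀ j ∈ s, g i = g j → f i = f j) :
    (s.image f).card ≤ (s.image g).card := by
  classical
  refine Finset.card_le_card_of_forall_subsingleton (fun b c => ∃ i ∈ s, f i = b ∧ g i = c) ?_ ?_
  · intro b hb
    obtain ⟨i, hi, rfl⟩ := Finset.mem_image.1 hb
    exact ⟨g i, Finset.mem_image_of_mem g hi, i, hi, rfl, rfl⟩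
  · rintro c - b₁ ⟨-, i, hi, rfl, h1⟩ b₂ ⟨-, j, hj, rfl, h2⟩
    exact h i hi j hj (h1.trans h2.symm)

/-! ### Sufficiency: bounded cores determine the relation. -/

namespace OrdEqRel

variable {B : Finset OrdEqRel}

instance : Finite (FactorVertex B) :=
  Finite.of_injective (fun μ => fun i j => μ.1.r i j) fun _ _ h =>
    Subtype.ext (Setoid.ext fun i j => iff_of_eq (congrFun (congrFun h i) j))

theorem hasSpecialOnCycle_iff :
    HasSpecialOnCycle B ↔
      ∃ μ, Relation.TransGen (factorGraph B).Adj μ μ ∧ IsSpecial μ := by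
  constructor
  · rintro ⟨l, hl, μ, hμ, hs⟩
    exact ⟨μ, hl.transGen hμ hμ, hs⟩
  · rintro ⟨μ, h, hs⟩
    obtain ⟨l, hl, hμ, -⟩ := Digraph.exists_isCycle h h
    exact ⟨l, hl, μ, hμ, hs⟩

theorem hasInOutCycle_iff :
    HasInOutCycle B ↔ ∃ x y, Relation.TransGen (factorGraph B).Adj x y ∧
      Relation.TransGen (factorGraph B).Adj y x ∧
      2 ≤ (factorGraph B).inDeg x ∧ 2 ≤ (factorGraph B).outDeg y := by
  constructor
  · rintro ⟨l, hl, ⟨x, hx, hx2⟩, ⟨y, hy, hy2⟩⟩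
    exact ⟨x, y, hl.transGen hx hy, hl.transGen hy hx, hx2, hy2⟩
  · rintro ⟨x, y, hxy, hyx, hx2, hy2⟩
    obtain ⟨l, hl, hx, hy⟩ := Digraph.exists_isCycle hxy hyx
    exact ⟨l, hl, ⟨x, hx, hx2⟩, ⟨y, hy, hy2⟩⟩

/-- If no vertex on a cycle has its last point in a class of size one, then no vertex on a cycle
has its first point in a class of size one. -/
theorem exists_eq_first_of_transGen (hb : 0 < maxLen B) (hs : ¬ HasSpecialOnCycle B)
    {μ : FactorVertex B} (hμ : Relation.TransGen (factorGraph B).Adj μ μ) {u : ℕ → ℕ}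
    (hu : Represents u μ) : ∃ i, 0 < i ∧ i < maxLen B ∧ u i = u 0 := by
  obtain ⟨l, hl, hmem, -⟩ := Digraph.exists_isCycle hμ hμ
  obtain ⟨L, hL, p₀, hp₀, hper, hmem₀⟩ := hl.exists_periodic
  obtain ⟨r, rfl⟩ := hmem₀ μ hmem
  obtain ⟨w, hw, -⟩ := exists_word_of_path fun i => p₀ (r + i)
  replace hw := fun t => hw t fun s _ => hp₀ (r + s)
  have hnot : ∀ t, ∃ i, i + 1 < maxLen B ∧ w (t + i) = w (t + (maxLen B - 1)) := by
    intro t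
    by_contra! hcon
    refine hs (hasSpecialOnCycle_iff.2 ⟨p₀ (r + t), ?_, ((hw t).isSpecial_iff hb).2 hcon⟩)
    conv => arg 3; rw [← hper]
    exact Digraph.transGen_of_path (by omega) fun i _ _ => hp₀ i
  -- No window on the cycle is special, so the label sets of successive windows can only shrink;
  -- after one period the cardinality is unchanged, so no label is ever lost.
  let S : ℕ → Finset ℕ := fun t => (Finset.range (maxLen B)).image fun i => w (t + i)
  have hS : Antitone S := by
    refine antitone_nat_of_succ_le fun t => ?_
    intro x hx
    obtain ⟨i, hi, rfl⟩ := Finset.mem_image.1 hx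
    rw [Finset.mem_range] at hi
    rcases Nat.lt_or_ge (i + 1) (maxLen B) with h | h
    · exact Finset.mem_image.2 ⟨i + 1, Finset.mem_range.2 h, by congr 1; omega⟩
    · obtain ⟨j, hj, he⟩ := hnot (t + 1)
      refine Finset.mem_image.2 ⟨j + 1, Finset.mem_range.2 hj, ?_⟩
      rw [show i = maxLen B - 1 by omega, ← he]
      congr 1
      omega
  have h0 := hw 0
  have hLw := hw L
  simp only [hper, Nat.add_zero] at h0 hLw
  have hSL : S 0 = S L := by
    refine (Finset.eq_of_subset_of_card_le (hS (Nat.zero_le L)) ?_).symm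
    refine Finset.card_image_le_of_factors fun i hi j hj h => ?_
    rw [Finset.mem_range] at hi hj
    exact (h0 i j hi hj).1 ((hLw i j hi hj).2 h)
  have h01 : w (0 + 0) ∈ S 1 :=
    hS hL (hSL ▸ Finset.mem_image_of_mem (fun i => w (0 + i)) (Finset.mem_range.2 hb))
  obtain ⟨i, hi, he⟩ := Finset.mem_image.1 h01
  rw [Finset.mem_range] at hi
  -- If the label recurs at the last point of window 1, just outside window 0, non-speciality moves
  -- it to an earlier point.
  obtain ⟨j, hj, hwj⟩ : ∃ j, j + 1 < maxLen B ∧ w (0 + (j + 1)) = w (0 + 0) := by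
    rcases Nat.lt_or_ge (i + 1) (maxLen B) with h | h
    · exact ⟨i, h, by rw [← he]; congr 1; omega⟩
    · obtain ⟨j, hj, hwj⟩ := hnot 1
      refine ⟨j, hj, ?_⟩
      rw [← he, show i = maxLen B - 1 by omega, ← hwj]
      congr 1
      omega
  exact ⟨j + 1, by omega, hj, (hu _ _ hj hb).1 ((h0 _ _ hj hb).2 hwj)⟩

/-- `v` and, shifted by `k`, `w` induce the same equivalence relation on `s`. -/
def SameOn (v w : ℕ → ℕ) (k : ℕ) (s : Set ℕ) : Prop :=
  ∀ i ∈ s, ∀ j ∈ s, (v i = v j ↔ w (k + i) = w (k + j))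

/-- The new point `r` can be replaced by `q`, its equivalent in both words, so even its distant
equivalences are settled. -/
theorem SameOn.extend {v w : ℕ → ℕ} {k q r : ℕ} {s t : Set ℕ} (h : SameOn v w k s)
    (ht : ∀ i ∈ t, i = r ∨ i ∈ s) (hq : q ∈ s) (hv : v q = v r) (hw : w (k + q) = w (k + r)) :
    SameOn v w k t := by
  have key : ∀ i ∈ t, ∃ i' ∈ s, v i = v i' ∧ w (k + i) = w (k + i') := by
    intro i hi
    rcases ht i hi with rfl | hi
    · exact ⟨q, hq, hv.symm, hw.symm⟩
    · exact ⟨i, hi, rfl, rfl⟩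
  intro i hi j hj
  obtain ⟨i', hi', h1, h2⟩ := key i hi
  obtain ⟨j', hwj, h3, h4⟩ := key j hj
  rw [h1, h2, h3, h4]
  exact h i' hi' j' hwj

theorem Represents.adj_of_windows {w : ℕ → ℕ} {t : ℕ} {μ ν : FactorVertex B}
    (hμ : Represents (fun i => w (t + i)) μ) (hν : Represents (fun i => w (t + 1 + i)) ν) :
    (factorGraph B).Adj μ ν := by
  refine (hμ.adj_iff hν).2 fun i j _ _ => ?_
  simp only [← Nat.add_assoc, Nat.add_right_comm]

variable (B) in
/-- The positions `a, …, a + d - 1` of a word of length `a + d + c` determine the induced ordered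
equivalence relation among the members of `Av B` of the same length. -/
def HasCore (w : ℕ → ℕ) (a d c : ℕ) : Prop :=
  (a = 0 ∧ c = 0) ∨ (maxLen B ≤ d ∧ ∃ p : ℕ → FactorVertex B,
    (∀ t, t + maxLen B ≤ a + d + c → Represents (fun i => w (t + i)) (p t)) ∧
    (∀ t < a, (∀ x y, (factorGraph B).Adj x (p (t + 1)) → (factorGraph B).Adj y (p (t + 1)) →
      x = y) ∧ ∃ i, 0 < i ∧ i < maxLen B ∧ w (t + i) = w t) ∧
    ∀ t, a + d ≤ t + maxLen B → t + maxLen B < a + d + c →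
      (∀ x y, (factorGraph B).Adj (p t) x → (factorGraph B).Adj (p t) y → x = y) ∧
      ∃ i, i + 1 < maxLen B ∧ w (t + 1 + i) = w (t + maxLen B))

/-- Align the cores and grow the agreement one point at a time. Uniqueness of the neighbouring
vertex forces the next window of `w`, which therefore has the same nearby equivalence as `v`. Of `w`
only avoidance of `B` is needed. -/
theorem HasCore.le {v w : ℕ → ℕ} {a d c a' c' : ℕ} (hv : HasCore B v a d c)
    (hw : ofFun (a' + d + c') w ∈ Av B) (ha : a ≤ a') (hc : c ≤ c')
    (h : ∀ i < d, ∀ j < d, (v (a + i) = v (a + j) ↔ w (a' + i) = w (a' + j))) :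
    ofFun (a + d + c) v ≤ ofFun (a' + d + c') w := by
  obtain ⟨k, rfl⟩ := Nat.exists_eq_add_of_le' ha
  suffices H : SameOn v w k (Set.Ico 0 (a + d + c)) from
    ofFun_le_ofFun.2 ⟨k, by omega, fun i hi j hj =>
      H i ⟨Nat.zero_le i, hi⟩ j ⟨Nat.zero_le j, hj⟩⟩
  have hcore : SameOn v w k (Set.Ico a (a + d)) := by
    rintro i ⟨hi1, hi2⟩ j ⟨hj1, hj2⟩
    have := h (i - a) (by omega) (j - a) (by omega)
    rwa [Nat.add_assoc, Nat.add_assoc, Nat.add_sub_of_le hi1, Nat.add_sub_of_le hj1] at this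
  rcases hv with ⟨rfl, rfl⟩ | ⟨hd, p, hp, hleft, hright⟩
  · simpa using hcore
  have hwin : ∀ t, t + maxLen B ≤ a + d + c →
      ∃ μ : FactorVertex B, Represents (fun i => w (k + t + i)) μ :=
    fun t ht => exists_vertex (shift_mem_Av hw (by omega))
  have hr : ∀ r, a + d ≤ r → r ≤ a + d + c → SameOn v w k (Set.Ico a r) := by
    intro r har
    induction r, har using Nat.le_induction with
    | base => exact fun _ => hcore
    | succ r har ih =>
      intro hrc
      have ih := ih (by omega)
      obtain ⟨t, rfl⟩ := Nat.exists_eq_add_of_le' (show maxLen B ≤ r by omega)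
      obtain ⟨hdet, i, hi, hi'⟩ := hright t har (by omega)
      obtain ⟨μ, hμ⟩ := hwin t (by omega)
      obtain ⟨ν, hν⟩ := hwin (t + 1) (by omega)
      have hpt := hp t (by omega)
      have hpt1 := hp (t + 1) (by omega)
      obtain rfl : p t = μ := by
        refine (hpt.eq_iff hμ).2 fun i hi j hj => ?_
        have := ih (t + i) ⟨by omega, by omega⟩ (t + j) ⟨by omega, by omega⟩
        simpa only [Nat.add_assoc] using this
      have hν' : p (t + 1) = ν := hdet _ _ (hpt.adj_of_windows hpt1) (hμ.adj_of_windows hν)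
      have heq := (hpt1.eq_iff hν).1 hν' i (by omega) (maxLen B - 1) (by omega)
      simp only [Nat.add_assoc] at heq hi'
      rw [show 1 + (maxLen B - 1) = maxLen B by omega] at heq
      refine ih.extend (r := t + maxLen B) (q := t + (1 + i)) ?_ ⟨by omega, by omega⟩ hi'
        (heq.1 hi')
      rintro j ⟨hj1, hj2⟩
      rcases Nat.lt_or_ge j (t + maxLen B) with h | h
      · exact .inr ⟨hj1, h⟩
      · exact .inl (by omega)
  have hl : ∀ l ≤ a, SameOn v w k (Set.Ico l (a + d + c)) := by
    intro l hla
    induction hla using Nat.decreasingInduction with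
    | self => exact hr _ (by omega) le_rfl
    | of_succ t hta ih =>
      obtain ⟨hdet, i, hi0, hi, hi'⟩ := hleft t hta
      obtain ⟨μ, hμ⟩ := hwin t (by omega)
      obtain ⟨ν, hν⟩ := hwin (t + 1) (by omega)
      have hpt := hp t (by omega)
      have hpt1 := hp (t + 1) (by omega)
      obtain rfl : p (t + 1) = ν := by
        refine (hpt1.eq_iff hν).2 fun i hi j hj => ?_
        have := ih (t + 1 + i) ⟨by omega, by omega⟩ (t + 1 + j) ⟨by omega, by omega⟩
        simpa only [Nat.add_assoc] using this
      have hμ' : p t = μ := hdet _ _ (hpt.adj_of_windows hpt1) (hμ.adj_of_windows hν)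
      have heq := (hpt.eq_iff hμ).1 hμ' i hi 0 (by omega)
      simp only [Nat.add_zero, Nat.add_assoc] at heq
      refine ih.extend (r := t) (q := t + i) ?_ ⟨by omega, by omega⟩ hi' (heq.1 hi')
      rintro j ⟨hj1, hj2⟩
      rcases Nat.lt_or_ge t j with h | h
      · exact .inr ⟨h, hj2⟩
      · exact .inl (by omega)
  exact hl 0 (Nat.zero_le a)

theorem exists_hasCore (hb : 0 < maxLen B) (hio : ¬ HasInOutCycle B) (hs : ¬ HasSpecialOnCycle B)
    {σ : OrdEqRel} (hσ : σ ∈ Av B) :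
    ∃ w a d c, d ≤ Nat.card (FactorVertex B) + 1 + maxLen B ∧ σ = ofFun (a + d + c) w ∧
      HasCore B w a d c := by
  obtain ⟨w, hw⟩ := exists_eq_ofFun σ
  generalize σ.len = n at hw
  subst hw
  rcases Nat.lt_or_ge n (maxLen B) with hn | hn
  · exact ⟨w, 0, n, 0, by omega, by simp, .inl ⟨rfl, rfl⟩⟩
  have hwin : ∀ t, ∃ μ : FactorVertex B, t + maxLen B ≤ n →
      Represents (fun i => w (t + i)) μ := by
    intro t
    by_cases ht : t + maxLen B ≤ n
    · obtain ⟨μ, hμ⟩ := exists_vertex (shift_mem_Av hσ ht)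
      exact ⟨μ, fun _ => hμ⟩
    · obtain ⟨μ, -⟩ := exists_vertex (shift_mem_Av hσ (show 0 + maxLen B ≤ n by omega))
      exact ⟨μ, fun h => absurd h ht⟩
  choose p hp using hwin
  obtain ⟨a, han, hl, hr⟩ := Digraph.exists_path_decomposition (G := factorGraph B)
    (fun x y hxy hyx h => hio (hasInOutCycle_iff.2 ⟨x, y, hxy, hyx, h⟩))
    (n := n + 1 - maxLen B) (by omega) (p := p)
    fun t ht => (hp t (by omega)).adj_of_windows (hp (t + 1) (by omega))
  have hmin : a + min (n - a) (Nat.card (FactorVertex B) + 1 + maxLen B) +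
      (n - a - min (n - a) (Nat.card (FactorVertex B) + 1 + maxLen B)) = n := by omega
  -- The core covers the irregular part of the walk plus one full window, or all that remains.
  refine ⟨w, a, min (n - a) (Nat.card (FactorVertex B) + 1 + maxLen B),
    n - a - min (n - a) (Nat.card (FactorVertex B) + 1 + maxLen B), min_le_right _ _,
    by rw [hmin], .inr ⟨by omega, p, ?_, ?_, ?_⟩⟩
  · rwa [hmin]
  · intro t ht
    obtain ⟨h1, h2⟩ := hl t ht
    obtain ⟨i, hi0, hi, hi'⟩ := exists_eq_first_of_transGen hb hs h1 (hp t (by omega))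
    exact ⟨h2, i, hi0, hi, hi'⟩
  · rw [hmin]
    intro t ht htn
    obtain ⟨h1, h2⟩ := hr t (by omega) (by omega)
    refine ⟨h2, ?_⟩
    by_contra! hcon
    refine hs (hasSpecialOnCycle_iff.2 ⟨_, h1,
      ((hp (t + 1) (by omega)).isSpecial_iff hb).2 fun i hi => ?_⟩)
    have := hcon i hi
    rwa [show t + maxLen B = t + 1 + (maxLen B - 1) by omega] at this

theorem avIsWQO_of_not (hb : 0 < maxLen B) (hio : ¬ HasInOutCycle B)
    (hs : ¬ HasSpecialOnCycle B) : AvIsWQO B := by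
  refine ⟨fun f => ?_⟩
  choose w a d c hd hf hcore using fun n => exists_hasCore hb hio hs (f n).2
  let M := Nat.card (FactorVertex B) + 1 + maxLen B
  let data : ℕ → ℕ × ℕ × Fin (M + 1) × (Fin M → Fin M → Prop) := fun n =>
    (a n, c n, ⟨d n, Nat.lt_succ_of_le (hd n)⟩, fun i j => w n (a n + i) = w n (a n + j))
  obtain ⟨m, n, hmn, h1, h2, h3⟩ := (wellQuasiOrdered_le (α := ℕ)).prod
    ((wellQuasiOrdered_le (α := ℕ)).prod
      (Finite.wellQuasiOrdered (α := Fin (M + 1) × (Fin M → Fin M → Prop)) (· = ·))) data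
  obtain ⟨h4, h5⟩ := Prod.ext_iff.1 h3
  have h4 : d m = d n := Fin.ext_iff.1 h4
  refine ⟨m, n, hmn, ?_⟩
  change (f m : OrdEqRel) ≤ f n
  have hn := (f n).2
  rw [hf n, ← h4] at hn
  rw [hf m, hf n, ← h4]
  refine (hcore m).le hn h1 h2 fun i hi j hj => ?_
  have hdm : d m ≤ M := hd m
  exact iff_of_eq (congrFun (congrFun h5 ⟨i, by omega⟩) ⟨j, by omega⟩)

theorem avIsWQO_iff_of_pos (hb : 0 < maxLen B) :
    AvIsWQO B ↔ ¬ HasInOutCycle B ∧ ¬ HasSpecialOnCycle B :=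
  ⟨fun h => ⟨fun h' => not_avIsWQO_of_hasInOutCycle h' h,
    fun h' => not_avIsWQO_of_hasSpecialOnCycle hb h' h⟩, fun h => avIsWQO_of_not hb h.1 h.2⟩

end OrdEqRel

/-! ### Closure properties of primitive recursive predicates. -/

namespace PrimrecPred

variable {α β : Type*} [Primcodable α] [Primcodable β]

theorem iff {p q : α → Prop} (hp : PrimrecPred p) (hq : PrimrecPred q) :
    PrimrecPred fun a => p a ↔ q a :=
  ((hp.and hq).or (hp.not.and hq.not)).of_eq fun a => by tauto

theorem imp {p q : α → Prop} (hp : PrimrecPred p) (hq : PrimrecPred q) :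
    PrimrecPred fun a => p a → q a :=
  (hp.not.or hq).of_eq fun a => by tauto

theorem ball {f : α → List β} {p : α → β → Prop} (hf : Primrec f)
    (hp : PrimrecPred fun x : α × β => p x.1 x.2) : PrimrecPred fun a => ∀ x ∈ f a, p a x :=
  (PrimrecRel.forall_mem_list (R := fun b a => p a b)
    (hp.comp (Primrec.pair Primrec.snd Primrec.fst))).comp hf Primrec.id

theorem bex {f : α → List β} {p : α → β → Prop} (hf : Primrec f)
    (hp : PrimrecPred fun x : α × β => p x.1 x.2) : PrimrecPred fun a => ∃ x ∈ f a, p a x :=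
  (PrimrecRel.exists_mem_list (R := fun b a => p a b)
    (hp.comp (Primrec.pair Primrec.snd Primrec.fst))).comp hf Primrec.id

theorem ball_lt {f : α → ℕ} {p : α → ℕ → Prop} (hf : Primrec f)
    (hp : PrimrecPred fun x : α × ℕ => p x.1 x.2) : PrimrecPred fun a => ∀ x < f a, p a x :=
  (ball (Primrec.list_range.comp hf) hp).of_eq fun a => by simp

theorem bex_lt {f : α → ℕ} {p : α → ℕ → Prop} (hf : Primrec f)
    (hp : PrimrecPred fun x : α × ℕ => p x.1 x.2) : PrimrecPred fun a => ∃ x < f a, p a x :=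
  (bex (Primrec.list_range.comp hf) hp).of_eq fun a => by simp

theorem mem {f : α → List β} {g : α → β} (hf : Primrec f) (hg : Primrec g) :
    PrimrecPred fun a => g a ∈ f a :=
  (bex hf (p := fun a x => x = g a)
    (Primrec.eq.comp Primrec.snd (hg.comp Primrec.fst))).of_eq fun a => by simp

end PrimrecPred

/-! ### Computing the factor graph on words. -/

namespace OrdEqRel

open Primrec

section Computation

/-- The window of length `n` at `s` of the word `u` and the one at `t` of the word `v` induce the
same equivalence relation. -/
def WindowsAgree (n s t : ℕ) (u v : List ℕ) : Prop :=
  ∀ i < n, ∀ j < n, (u.getD (s + i) 0 = u.getD (s + j) 0 ↔ v.getD (t + i) 0 = v.getD (t + j) 0)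

theorem primrecPred_windowsAgree {α : Type*} [Primcodable α] {n s t : α → ℕ} {u v : α → List ℕ}
    (hn : Primrec n) (hs : Primrec s) (ht : Primrec t) (hu : Primrec u) (hv : Primrec v) :
    PrimrecPred fun a => WindowsAgree (n a) (s a) (t a) (u a) (v a) := by
  have hget : ∀ {l : α → List ℕ} {k : α → ℕ} {f : (α × ℕ) × ℕ → ℕ}, Primrec l → Primrec k →
      Primrec f → Primrec fun x : (α × ℕ) × ℕ => (l x.1.1).getD (k x.1.1 + f x) 0 :=
    fun hl hk hf => (list_getD 0).comp (hl.comp (fst.comp fst))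
      (nat_add.comp (hk.comp (fst.comp fst)) hf)
  have hi : Primrec fun x : (α × ℕ) × ℕ => x.1.2 := snd.comp fst
  refine PrimrecPred.ball_lt hn (PrimrecPred.ball_lt (hn.comp fst) (PrimrecPred.iff ?_ ?_))
  · exact Primrec.eq.comp (hget hu hs hi) (hget hu hs snd)
  · exact Primrec.eq.comp (hget hv ht hi) (hget hv ht snd)

/-- The greatest length of a word in a list. -/
def maxLength (l : List (List ℕ)) : ℕ :=
  l.foldr (fun w m => max w.length m) 0

theorem primrec_maxLength : Primrec maxLength :=
  list_foldr Primrec.id (const 0)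
    ((nat_max.comp (list_length.comp (fst.comp snd)) (snd.comp snd)).to₂)

/-- All words of length `n` in letters smaller than `k`. -/
def wordsBelow (k n : ℕ) : List (List ℕ) :=
  n.rec [[]] fun _ L => L.flatMap fun u => (List.range k).map fun x => x :: u

theorem primrec_wordsBelow : Primrec₂ wordsBelow := by
  refine Primrec.nat_rec (f := fun _ : ℕ => ([[]] : List (List ℕ)))
    (g := fun k x => x.2.flatMap fun u => (List.range k).map fun x => x :: u) (const _) ?_
  refine list_flatMap (snd.comp snd) ?_
  refine list_map (list_range.comp (fst.comp fst)) ?_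
  exact list_cons.comp snd (snd.comp fst)

theorem mem_wordsBelow {k n : ℕ} {u : List ℕ} :
    u ∈ wordsBelow k n ↔ u.length = n ∧ ∀ x ∈ u, x < k := by
  induction n generalizing u with
  | zero =>
    have hzero : wordsBelow k 0 = [[]] := rfl
    rw [hzero, List.mem_singleton, List.length_eq_zero_iff]
    constructor
    · rintro rfl
      simp
    · exact fun h => h.1
  | succ n ih =>
    have hstep : wordsBelow k (n + 1) =
      (wordsBelow k n).flatMap fun u => (List.range k).map fun x => x :: u := rfl
    rw [hstep]
    simp only [List.mem_flatMap, List.mem_map, List.mem_range]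
    constructor
    · rintro ⟨v, hv, x, hx, rfl⟩
      obtain ⟨h1, h2⟩ := ih.1 hv
      exact ⟨by simp [h1], by simpa [hx] using h2⟩
    · rintro ⟨h1, h2⟩
      match u, h1, h2 with
      | x :: v, h1, h2 =>
        exact ⟨v, ih.2 ⟨by simpa using h1, fun y hy => h2 y (List.mem_cons_of_mem _ hy)⟩, x,
          h2 x List.mem_cons_self, rfl⟩

/-- A list of sublists of a list, among them all those obtained by filtering. -/
def subsetsOf {α : Type*} (l : List α) : List (List α) :=
  l.foldr (fun a L => L ++ L.map (List.cons a)) [[]]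

theorem primrec_subsetsOf {α : Type*} [Primcodable α] :
    Primrec (subsetsOf : List α → List (List α)) := by
  refine list_foldr (g := fun _ => [[]])
    (h := fun _ x => x.2 ++ x.2.map (List.cons x.1)) Primrec.id (const _) ?_
  refine list_append.comp (snd.comp snd) (list_map (snd.comp snd) ?_)
  exact list_cons.comp (fst.comp (snd.comp fst)) snd

theorem filter_mem_subsetsOf {α : Type*} (p : α → Bool) (l : List α) :
    l.filter p ∈ subsetsOf l := by
  induction l with
  | nil => simp [subsetsOf]
  | cons a l ih =>
    have h : subsetsOf (a :: l) = subsetsOf l ++ (subsetsOf l).map (List.cons a) := rfl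
    rw [h, List.mem_append, List.filter_cons]
    split_ifs
    · exact .inr (List.mem_map_of_mem ih)
    · exact .inl ih

/-- The word `w` occurs, up to renaming of letters, as a factor of `u`. -/
def OccursIn (w u : List ℕ) : Prop :=
  ∃ k < u.length + 1, k + w.length ≤ u.length ∧ WindowsAgree w.length 0 k w u

theorem ofWord_le_ofWord_iff {w u : List ℕ} : ofWord w ≤ ofWord u ↔ OccursIn w u := by
  rw [ofWord_eq_ofFun, ofWord_eq_ofFun, ofFun_le_ofFun]
  constructor
  · rintro ⟨k, hk, h⟩
    exact ⟨k, by omega, hk, by simpa only [WindowsAgree, Nat.zero_add] using h⟩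
  · rintro ⟨k, -, hk, h⟩
    exact ⟨k, hk, by simpa only [WindowsAgree, Nat.zero_add] using h⟩

theorem primrecPred_occursIn {α : Type*} [Primcodable α] {w u : α → List ℕ} (hw : Primrec w)
    (hu : Primrec u) : PrimrecPred fun a => OccursIn (w a) (u a) := by
  refine PrimrecPred.bex_lt (succ.comp (list_length.comp hu)) (PrimrecPred.and ?_ ?_)
  · exact nat_le.comp (nat_add.comp snd (list_length.comp (hw.comp fst)))
      (list_length.comp (hu.comp fst))
  · exact primrecPred_windowsAgree (list_length.comp (hw.comp fst)) (const 0) snd (hw.comp fst)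
      (hu.comp fst)

/-- The word `u` avoids all words of `l`. -/
def Avoids (l : List (List ℕ)) (u : List ℕ) : Prop :=
  ∀ w ∈ l, ¬ OccursIn w u

theorem avoids_iff {l : List (List ℕ)} {u : List ℕ} :
    Avoids l u ↔ ofWord u ∈ Av (ofWords l) := by
  simp [Avoids, Av, mem_ofWords, ofWord_le_ofWord_iff]

theorem primrecRel_avoids : PrimrecRel Avoids :=
  PrimrecPred.ball fst (primrecPred_occursIn snd (snd.comp fst)).not

open Classical in
/-- Words representing the vertices of the factor graph of a list of words. -/
noncomputable def vertexWords (l : List (List ℕ)) : List (List ℕ) :=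
  (wordsBelow (maxLength l) (maxLength l)).filter fun u => Avoids l u

theorem primrec_vertexWords : Primrec vertexWords := by
  classical
  exact (PrimrecRel.listFilter (R := fun u l => Avoids l u) (primrecRel_avoids.comp snd fst)).comp
    (primrec_wordsBelow.comp primrec_maxLength primrec_maxLength) Primrec.id

/-- Adjacency in the factor graph in terms of words. -/
def WordAdj (l : List (List ℕ)) (u v : List ℕ) : Prop :=
  WindowsAgree (maxLength l - 1) 1 0 u v

variable {α : Type*} [Primcodable α] {l : α → List (List ℕ)} {u v : α → List ℕ}

theorem primrecPred_wordAdj (hl : Primrec l) (hu : Primrec u) (hv : Primrec v) :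
    PrimrecPred fun a => WordAdj (l a) (u a) (v a) :=
  primrecPred_windowsAgree (nat_sub.comp (primrec_maxLength.comp hl) (const 1)) (const 1) (const 0)
    hu hv

/-- There is a nonempty path from `u` to `v`, expressed in terms of successor-closed sets. -/
def WordReach (l : List (List ℕ)) (u v : List ℕ) : Prop :=
  ∀ S ∈ subsetsOf (vertexWords l), (∀ y ∈ vertexWords l, WordAdj l u y → y ∈ S) →
    (∀ x ∈ S, ∀ y ∈ vertexWords l, WordAdj l x y → y ∈ S) → v ∈ S

theorem primrecPred_wordReach (hl : Primrec l) (hu : Primrec u) (hv : Primrec v) :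
    PrimrecPred fun a => WordReach (l a) (u a) (v a) := by
  refine PrimrecPred.ball (primrec_subsetsOf.comp (primrec_vertexWords.comp hl))
    (PrimrecPred.imp ?_ (PrimrecPred.imp ?_ ?_))
  · refine PrimrecPred.ball (primrec_vertexWords.comp (hl.comp fst)) (PrimrecPred.imp ?_ ?_)
    · exact primrecPred_wordAdj (hl.comp (fst.comp fst)) (hu.comp (fst.comp fst)) snd
    · exact PrimrecPred.mem (snd.comp fst) snd
  · refine PrimrecPred.ball snd (PrimrecPred.ball
      (primrec_vertexWords.comp (hl.comp (fst.comp fst))) (PrimrecPred.imp ?_ ?_))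
    · exact primrecPred_wordAdj (hl.comp (fst.comp (fst.comp fst))) (snd.comp fst) snd
    · exact PrimrecPred.mem (snd.comp (fst.comp fst)) snd
  · exact PrimrecPred.mem snd (hv.comp fst)

/-- The vertex represented by `u` has two different predecessors. -/
def WordBranchIn (l : List (List ℕ)) (u : List ℕ) : Prop :=
  ∃ x ∈ vertexWords l, ∃ y ∈ vertexWords l, WordAdj l x u ∧ WordAdj l y u ∧
    ¬ WindowsAgree (maxLength l) 0 0 x y

/-- The vertex represented by `u` has two different successors. -/
def WordBranchOut (l : List (List ℕ)) (u : List ℕ) : Prop :=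
  ∃ x ∈ vertexWords l, ∃ y ∈ vertexWords l, WordAdj l u x ∧ WordAdj l u y ∧
    ¬ WindowsAgree (maxLength l) 0 0 x y

theorem primrecPred_wordBranchIn (hl : Primrec l) (hu : Primrec u) :
    PrimrecPred fun a => WordBranchIn (l a) (u a) := by
  have hl2 : Primrec fun x : (α × List ℕ) × List ℕ => l x.1.1 := hl.comp (fst.comp fst)
  have hu2 : Primrec fun x : (α × List ℕ) × List ℕ => u x.1.1 := hu.comp (fst.comp fst)
  exact PrimrecPred.bex (primrec_vertexWords.comp hl) (PrimrecPred.bex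
    (primrec_vertexWords.comp (hl.comp fst)) ((primrecPred_wordAdj hl2 (snd.comp fst) hu2).and
      ((primrecPred_wordAdj hl2 snd hu2).and (primrecPred_windowsAgree
        (primrec_maxLength.comp hl2) (const 0) (const 0) (snd.comp fst) snd).not)))

theorem primrecPred_wordBranchOut (hl : Primrec l) (hu : Primrec u) :
    PrimrecPred fun a => WordBranchOut (l a) (u a) := by
  have hl2 : Primrec fun x : (α × List ℕ) × List ℕ => l x.1.1 := hl.comp (fst.comp fst)
  have hu2 : Primrec fun x : (α × List ℕ) × List ℕ => u x.1.1 := hu.comp (fst.comp fst)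
  exact PrimrecPred.bex (primrec_vertexWords.comp hl) (PrimrecPred.bex
    (primrec_vertexWords.comp (hl.comp fst)) ((primrecPred_wordAdj hl2 hu2 (snd.comp fst)).and
      ((primrecPred_wordAdj hl2 hu2 snd).and (primrecPred_windowsAgree
        (primrec_maxLength.comp hl2) (const 0) (const 0) (snd.comp fst) snd).not)))

/-- The last letter of `u` occurs only once. -/
def WordSpecial (l : List (List ℕ)) (u : List ℕ) : Prop :=
  0 < maxLength l ∧ ∀ i < maxLength l - 1, ¬ u.getD i 0 = u.getD (maxLength l - 1) 0

theorem primrecPred_wordSpecial (hl : Primrec l) (hu : Primrec u) :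
    PrimrecPred fun a => WordSpecial (l a) (u a) := by
  have hlast : Primrec fun a => maxLength (l a) - 1 :=
    nat_sub.comp (primrec_maxLength.comp hl) (const 1)
  exact (nat_lt.comp (const 0) (primrec_maxLength.comp hl)).and (PrimrecPred.ball_lt hlast
    (Primrec.eq.comp ((list_getD 0).comp (hu.comp fst) snd)
      ((list_getD 0).comp (hu.comp fst) (hlast.comp fst))).not)

end Computation

/-! ### Correctness of the computation. -/

section Correctness

variable {l : List (List ℕ)}

theorem maxLen_ofWords : maxLen (ofWords l) = maxLength l := by
  refine le_antisymm (Finset.sup_le fun σ hσ => ?_) ?_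
  · obtain ⟨w, hw, rfl⟩ := mem_ofWords.1 hσ
    change w.length ≤ _
    clear hσ
    induction l with
    | nil => simp at hw
    | cons v l ih =>
      have h : maxLength (v :: l) = max v.length (maxLength l) := rfl
      rcases List.mem_cons.1 hw with rfl | hw
      · omega
      · have := ih hw
        omega
  · suffices H : ∀ m, (∀ w ∈ l, w.length ≤ m) → maxLength l ≤ m from
      H _ fun w hw => len_le_maxLen (mem_ofWords.2 ⟨w, hw, rfl⟩)
    intro m hm
    induction l with
    | nil => simp [maxLength]
    | cons v l ih =>
      have h : maxLength (v :: l) = max v.length (maxLength l) := rfl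
      rw [h]
      exact max_le (hm v List.mem_cons_self) (ih fun w hw => hm w (List.mem_cons_of_mem _ hw))

/-- The word `u` induces the vertex `μ`. -/
abbrev WordRepresents (u : List ℕ) (μ : FactorVertex (ofWords l)) : Prop :=
  Represents (fun i => u.getD i 0) μ

theorem exists_wordRepresents {u : List ℕ} (hu : u ∈ vertexWords l) :
    ∃ μ : FactorVertex (ofWords l), WordRepresents u μ := by
  simp only [vertexWords, List.mem_filter, mem_wordsBelow, decide_eq_true_eq] at hu
  have h := avoids_iff.1 hu.2
  rw [ofWord_eq_ofFun, hu.1.1, ← maxLen_ofWords] at h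
  exact exists_vertex h

theorem exists_mem_vertexWords (μ : FactorVertex (ofWords l)) :
    ∃ u ∈ vertexWords l, WordRepresents u μ := by
  obtain ⟨w, hw⟩ := exists_represents μ
  -- Relabel each point by the first position with its label, so that letters stay below b.
  have hex : ∀ i, ∃ j, w j = w i := fun i => ⟨i, rfl⟩
  have hfind : ∀ i, w (Nat.find (hex i)) = w i := fun i => Nat.find_spec (hex i)
  have hget : ∀ i < maxLen (ofWords l), ((List.range (maxLen (ofWords l))).map
      fun i => Nat.find (hex i)).getD i 0 = Nat.find (hex i) := by
    intro i hi
    simp [List.getD_eq_getElem?_getD, hi]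
  have hrep : WordRepresents ((List.range (maxLen (ofWords l))).map fun i => Nat.find (hex i))
      μ := by
    refine hw.congr fun i hi j hj => ?_
    rw [hget i hi, hget j hj]
    refine ⟨fun h => ?_, fun h => by rw [← hfind i, h, hfind j]⟩
    simp only [h]
  refine ⟨_, ?_, hrep⟩
  simp only [vertexWords, List.mem_filter, mem_wordsBelow, decide_eq_true_eq]
  refine ⟨⟨by simp [maxLen_ofWords], fun x hx => ?_⟩, ?_⟩
  · obtain ⟨i, hi, rfl⟩ := List.mem_map.1 hx
    rw [List.mem_range, maxLen_ofWords] at hi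
    exact (Nat.find_min' (hex i) rfl).trans_lt hi
  · rw [avoids_iff, ofWord_eq_ofFun]
    simpa using hrep.mem_Av

variable {u v : List ℕ} {μ ν : FactorVertex (ofWords l)}

theorem wordAdj_iff (hu : WordRepresents u μ) (hv : WordRepresents v ν) :
    WordAdj l u v ↔ (factorGraph (ofWords l)).Adj μ ν := by
  rw [hu.adj_iff hv, WordAdj, WindowsAgree, maxLen_ofWords]
  simp only [Nat.zero_add, Nat.add_comm 1]
  exact ⟨fun h i j hi hj => h i (by omega) j (by omega),
    fun h i hi j hj => h i j (by omega) (by omega)⟩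

theorem windowsAgree_iff_eq (hu : WordRepresents u μ) (hv : WordRepresents v ν) :
    WindowsAgree (maxLength l) 0 0 u v ↔ μ = ν := by
  rw [hu.eq_iff hv, WindowsAgree, maxLen_ofWords]
  simp only [Nat.zero_add]

theorem wordReach_iff (hu : WordRepresents u μ) (hv : WordRepresents v ν)
    (hvl : v ∈ vertexWords l) :
    WordReach l u v ↔ Relation.TransGen (factorGraph (ofWords l)).Adj μ ν := by
  classical
  constructor
  · intro h
    -- Test `WordReach` on the successor-closed set of words for vertices reachable from `μ`.
    have hmem : ∀ {x : List ℕ}, x ∈ (vertexWords l).filter (fun x =>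
        ∃ ξ : FactorVertex (ofWords l), WordRepresents x ξ ∧
          Relation.TransGen (factorGraph (ofWords l)).Adj μ ξ) ↔ x ∈ vertexWords l ∧
        ∃ ξ : FactorVertex (ofWords l), WordRepresents x ξ ∧
          Relation.TransGen (factorGraph (ofWords l)).Adj μ ξ := by
      intro x
      rw [List.mem_filter, decide_eq_true_eq]
    have h1 := h _ (filter_mem_subsetsOf _ _) (fun y hy huy => hmem.2 ⟨hy, ?_⟩)
      (fun x hx y hy hxy => hmem.2 ⟨hy, ?_⟩)
    · obtain ⟨-, ξ, hξ, hμξ⟩ := hmem.1 h1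
      obtain rfl : ξ = ν := (hξ.eq_iff hv).2 fun _ _ _ _ => Iff.rfl
      exact hμξ
    · obtain ⟨ξ, hξ⟩ := exists_wordRepresents hy
      exact ⟨ξ, hξ, .single ((wordAdj_iff hu hξ).1 huy)⟩
    · obtain ⟨-, η, hη, hμη⟩ := hmem.1 hx
      obtain ⟨ξ, hξ⟩ := exists_wordRepresents hy
      exact ⟨ξ, hξ, hμη.tail ((wordAdj_iff hη hξ).1 hxy)⟩
  · intro h S _ h1 h2
    -- A vertex may have several words, so the induction covers all of them.
    suffices H : ∀ x ∈ vertexWords l, WordRepresents x ν → x ∈ S from H v hvl hv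
    clear hv hvl
    induction h with
    | single h => exact fun x hx hxν => h1 x hx ((wordAdj_iff hu hxν).2 h)
    | tail _ h ih =>
      intro x hx hxν
      obtain ⟨y, hy, hyμ⟩ := exists_mem_vertexWords _
      exact h2 y (ih y hy hyμ) x hx ((wordAdj_iff hyμ hxν).2 h)

theorem wordBranchIn_iff (hu : WordRepresents u μ) :
    WordBranchIn l u ↔ 2 ≤ (factorGraph (ofWords l)).inDeg μ := by
  rw [Digraph.two_le_inDeg_iff]
  constructor
  · rintro ⟨x, hx, y, hy, hxu, hyu, hxy⟩
    obtain ⟨ξ, hξ⟩ := exists_wordRepresents hx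
    obtain ⟨η, hη⟩ := exists_wordRepresents hy
    exact ⟨ξ, η, (wordAdj_iff hξ hu).1 hxu, (wordAdj_iff hη hu).1 hyu,
      fun h => hxy ((windowsAgree_iff_eq hξ hη).2 h)⟩
  · rintro ⟨ξ, η, hxu, hyu, hxy⟩
    obtain ⟨x, hx, hξ⟩ := exists_mem_vertexWords ξ
    obtain ⟨y, hy, hη⟩ := exists_mem_vertexWords η
    exact ⟨x, hx, y, hy, (wordAdj_iff hξ hu).2 hxu, (wordAdj_iff hη hu).2 hyu,
      fun h => hxy ((windowsAgree_iff_eq hξ hη).1 h)⟩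

theorem wordBranchOut_iff (hu : WordRepresents u μ) :
    WordBranchOut l u ↔ 2 ≤ (factorGraph (ofWords l)).outDeg μ := by
  rw [Digraph.two_le_outDeg_iff]
  constructor
  · rintro ⟨x, hx, y, hy, hxu, hyu, hxy⟩
    obtain ⟨ξ, hξ⟩ := exists_wordRepresents hx
    obtain ⟨η, hη⟩ := exists_wordRepresents hy
    exact ⟨ξ, η, (wordAdj_iff hu hξ).1 hxu, (wordAdj_iff hu hη).1 hyu,
      fun h => hxy ((windowsAgree_iff_eq hξ hη).2 h)⟩
  · rintro ⟨ξ, η, hxu, hyu, hxy⟩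
    obtain ⟨x, hx, hξ⟩ := exists_mem_vertexWords ξ
    obtain ⟨y, hy, hη⟩ := exists_mem_vertexWords η
    exact ⟨x, hx, y, hy, (wordAdj_iff hu hξ).2 hxu, (wordAdj_iff hu hη).2 hyu,
      fun h => hxy ((windowsAgree_iff_eq hξ hη).1 h)⟩

theorem wordSpecial_iff (hu : WordRepresents u μ) : WordSpecial l u ↔ IsSpecial μ := by
  have hb : IsSpecial μ → 0 < maxLen (ofWords l) := fun ⟨m, _⟩ => m.pos
  constructor
  · rintro ⟨h0, h⟩
    rw [← maxLen_ofWords] at h0 h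
    exact (hu.isSpecial_iff h0).2 fun i hi => h i (by omega)
  · intro h
    have h1 := (hu.isSpecial_iff (hb h)).1 h
    refine ⟨maxLen_ofWords (l := l) ▸ hb h, fun i hi => ?_⟩
    rw [← maxLen_ofWords] at hi ⊢
    exact h1 i (by omega)

theorem hasInOutCycle_ofWords_iff :
    HasInOutCycle (ofWords l) ↔ ∃ u ∈ vertexWords l, ∃ v ∈ vertexWords l, WordReach l u v ∧
      WordReach l v u ∧ WordBranchIn l u ∧ WordBranchOut l v := by
  rw [hasInOutCycle_iff]
  constructor
  · rintro ⟨μ, ν, h1, h2, h3, h4⟩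
    obtain ⟨u, hu, hμ⟩ := exists_mem_vertexWords μ
    obtain ⟨v, hv, hν⟩ := exists_mem_vertexWords ν
    exact ⟨u, hu, v, hv, (wordReach_iff hμ hν hv).2 h1, (wordReach_iff hν hμ hu).2 h2,
      (wordBranchIn_iff hμ).2 h3, (wordBranchOut_iff hν).2 h4⟩
  · rintro ⟨u, hu, v, hv, h1, h2, h3, h4⟩
    obtain ⟨μ, hμ⟩ := exists_wordRepresents hu
    obtain ⟨ν, hν⟩ := exists_wordRepresents hv
    exact ⟨μ, ν, (wordReach_iff hμ hν hv).1 h1, (wordReach_iff hν hμ hu).1 h2,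
      (wordBranchIn_iff hμ).1 h3, (wordBranchOut_iff hν).1 h4⟩

theorem hasSpecialOnCycle_ofWords_iff :
    HasSpecialOnCycle (ofWords l) ↔
      ∃ u ∈ vertexWords l, WordReach l u u ∧ WordSpecial l u := by
  rw [hasSpecialOnCycle_iff]
  constructor
  · rintro ⟨μ, h1, h2⟩
    obtain ⟨u, hu, hμ⟩ := exists_mem_vertexWords μ
    exact ⟨u, hu, (wordReach_iff hμ hμ hu).2 h1, (wordSpecial_iff hμ).2 h2⟩
  · rintro ⟨u, hu, h1, h2⟩
    obtain ⟨μ, hμ⟩ := exists_wordRepresents hu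
    exact ⟨μ, (wordReach_iff hμ hμ hu).1 h1, (wordSpecial_iff hμ).1 h2⟩

theorem avIsWQO_of_maxLen_eq_zero {B : Finset OrdEqRel} (hB : B.Nonempty) (h : maxLen B = 0) :
    AvIsWQO B := by
  obtain ⟨β, hβ⟩ := hB
  refine ⟨fun f => ((f 0).2 β hβ ?_).elim⟩
  have h0 : β.len = 0 := Nat.le_zero.1 (h ▸ len_le_maxLen hβ)
  obtain ⟨v, hv⟩ := exists_eq_ofFun β
  obtain ⟨w, hw⟩ := exists_eq_ofFun (f 0 : OrdEqRel)
  rw [hv, hw, ofFun_le_ofFun]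
  exact ⟨0, by omega, fun i hi => by omega⟩

/-- For b = 0 the graph is not used: either `B` is empty and `Av B` is not wqo, or `B` contains the
empty relation and `Av B` is empty. -/
theorem avIsWQO_ofWords_iff :
    AvIsWQO (ofWords l) ↔ (¬ 0 < maxLength l ∧ ¬ l = []) ∨
      (0 < maxLength l ∧ ¬ HasInOutCycle (ofWords l) ∧ ¬ HasSpecialOnCycle (ofWords l)) := by
  rw [← maxLen_ofWords]
  by_cases h : 0 < maxLen (ofWords l)
  · simp [h, avIsWQO_iff_of_pos h]
  · simp only [h, not_false_eq_true, true_and, false_and, or_false]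
    constructor
    · rintro h1 rfl
      exact not_avIsWQO_empty (by simpa [ofWords] using h1)
    · intro hl
      obtain ⟨w, hw⟩ := List.exists_mem_of_ne_nil l hl
      exact avIsWQO_of_maxLen_eq_zero ⟨_, mem_ofWords.2 ⟨w, hw, rfl⟩⟩ (by omega)

end Correctness

/-! ### Decidability and the final theorem. -/

theorem primrecPred_hasInOutCycle : PrimrecPred fun l => HasInOutCycle (ofWords l) := by
  have hl : Primrec fun x : (List (List ℕ) × List ℕ) × List ℕ => x.1.1 := fst.comp fst
  have hu : Primrec fun x : (List (List ℕ) × List ℕ) × List ℕ => x.1.2 := snd.comp fst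
  refine PrimrecPred.of_eq ?_ fun l => hasInOutCycle_ofWords_iff.symm
  exact PrimrecPred.bex primrec_vertexWords (PrimrecPred.bex (primrec_vertexWords.comp fst)
    ((primrecPred_wordReach hl hu snd).and ((primrecPred_wordReach hl snd hu).and
      ((primrecPred_wordBranchIn hl hu).and (primrecPred_wordBranchOut hl snd)))))

theorem primrecPred_hasSpecialOnCycle : PrimrecPred fun l => HasSpecialOnCycle (ofWords l) := by
  refine PrimrecPred.of_eq ?_ fun l => hasSpecialOnCycle_ofWords_iff.symm
  exact PrimrecPred.bex primrec_vertexWords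
    ((primrecPred_wordReach fst snd snd).and (primrecPred_wordSpecial fst snd))

theorem primrecPred_avIsWQO : PrimrecPred fun l => AvIsWQO (ofWords l) := by
  have hpos : PrimrecPred fun l => 0 < maxLength l := nat_lt.comp (const 0) primrec_maxLength
  refine PrimrecPred.of_eq ?_ fun l => avIsWQO_ofWords_iff.symm
  exact (hpos.not.and (Primrec.eq.comp Primrec.id (const [])).not).or
    (hpos.and (primrecPred_hasInOutCycle.not.and primrecPred_hasSpecialOnCycle.not))

end OrdEqRel

theorem theorem8p4 :
    ComputablePred (fun l : List (List ℕ) => OrdEqRel.AvIsWQO (OrdEqRel.ofWords l)) ∧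
    (∀ B : Finset OrdEqRel, (∃ β ∈ B, 0 < β.len) →
      (OrdEqRel.AvIsWQO B ↔
        ¬ OrdEqRel.HasInOutCycle B ∧ ¬ OrdEqRel.HasSpecialOnCycle B)) ∧
    ComputablePred (fun l : List (List ℕ) => OrdEqRel.HasInOutCycle (OrdEqRel.ofWords l)) ∧
    ComputablePred (fun l : List (List ℕ) =>
      OrdEqRel.HasSpecialOnCycle (OrdEqRel.ofWords l)) :=
  ⟨OrdEqRel.primrecPred_avIsWQO.computablePred,
    fun _ ⟨_, hβ, hpos⟩ => OrdEqRel.avIsWQO_iff_of_pos (hpos.trans_le (OrdEqRel.len_le_maxLen hβ)),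
    OrdEqRel.primrecPred_hasInOutCycle.computablePred,
    OrdEqRel.primrecPred_hasSpecialOnCycle.computablePred⟩
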